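/- Let $R$ be a commutative noetherian ring with only finitely many maximal ideals, let $M$ be a nonzero finitely generated $R$-module, and let $S=\mathrm{End}_R(M)$, with Jacobson radical $J(S)$. Let $V^*(M)$ be the commutative monoid of isomorphism classes $[X]$ of countably generated $R$-modules $X$ that are isomorphic to direct summands of direct sums of (arbitrarily many) copies of $M$, with addition $[X]+[Y]=[X\oplus Y]$. Let $\mathbb N_0^*=\mathbb N_0\cup\{\infty\}$, with its usual addition. Then $S$ has, up to isomorphism, only finitely many simple right modules. Let $V_1,\dots,V_s$ be a complete list of pairwise non-isomorphic representatives of them, and let $D_i=\mathrm{End}_S(V_i)$, a division ring. For a right $S$-module $P$ set $$\mathbf{dim}_S(P)=\big(\dim_{D_i}\mathrm{Hom}_S(V_i,P/PJ(S))\big)_{i=1}^s\in(\mathbb N_0^*)^s,$$ where every infinite dimension is written $\infty$, and set $\mathbf D_M([X])=\mathbf{dim}_S(\mathrm{Hom}_R(M,X))$. Then $$\mathbf D_M\colon V^*(M)\to(\mathbb N_0^*)^s$$ is a well-defined injective morphism of monoids, and it is a divisor homomorphism: if $[X],[Y]\in V^*(M)$ and $\mathbf D_M([Y])=\mathbf D_M([X])+c$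 for some $c\in(\mathbb N_0^*)^s$, then $[Y]=[X]+[Z]$ for some $[Z]\in V^*(M)$. -/

import Mathlib

universe u v w

namespace DirectSummands

section Precomp

variable (R : Type u) [Ring R] (M : Type v) [AddCommGroup M] [Module R M]

/-- The opposite ring of `S = End_R(M)`. Left modules over it are the right `S`-modules. -/
abbrev EndOp : Type v := (Module.End R M)ᵐᵒᵖ

variable {R M} {X : Type w} [AddCommGroup X] [Module R X]

/-- `Hom_R(M, X)` is a right module over `End_R(M)` by composition: `f · a = f ∘ a`. -/
instance precompModule : Module (EndOp R M) (M →ₗ[R] X) where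
  smul a f := f.comp a.unop
  one_smul _ := rfl
  mul_smul _ _ _ := rfl
  smul_zero _ := LinearMap.zero_comp _
  smul_add _ _ _ := LinearMap.add_comp _ _ _
  add_smul _ _ _ := LinearMap.comp_add _ _ _
  zero_smul _ := LinearMap.comp_zero _

/-- An isomorphism `X ≃ Y` induces an isomorphism `Hom_R(M, X) ≃ Hom_R(M, Y)` of right
`End_R(M)`-modules. -/
def homCongr {Y : Type w} [AddCommGroup Y] [Module R Y] (e : X ≃ₗ[R] Y) :
    (M →ₗ[R] X) ≃ₗ[EndOp R M] (M →ₗ[R] Y) where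
  toFun f := (e : X →ₗ[R] Y).comp f
  invFun g := (e.symm : Y →ₗ[R] X).comp g
  map_add' _ _ := LinearMap.comp_add _ _ _
  map_smul' _ _ := rfl
  left_inv f := by ext; simp
  right_inv g := by ext; simp

end Precomp

section VStar

variable (R : Type u) [Ring R] (M : Type v) [AddCommGroup M] [Module R M]

/-- `X` is a countably generated `R`-module. -/
def IsCountablyGenerated (X : Type v) [AddCommGroup X] [Module R X] : Prop :=
  ∃ A : Set X, A.Countable ∧ Submodule.span R A = ⊤

/-- `X` belongs to `Add(M)`: it is isomorphic to a direct summand of a direct sum `M^(I)` of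
an arbitrary number of copies of `M`. -/
def InAdd (X : Type v) [AddCommGroup X] [Module R X] : Prop :=
  ∃ (I : Type v) (Y : ModuleCat.{v} R), Nonempty ((X × Y) ≃ₗ[R] (I →₀ M))

/-- The countably generated modules in `Add(M)`. -/
def AddCtbl : Type (max u (v + 1)) :=
  {X : ModuleCat.{v} R // IsCountablyGenerated R X ∧ InAdd R M X}

/-- Isomorphism of countably generated modules in `Add(M)`. -/
def isoSetoid : Setoid (AddCtbl R M) where
  r X Y := Nonempty (X.1 ≃ₗ[R] Y.1)
  iseqv :=
    { refl := fun _ => ⟨LinearEquiv.refl _ _⟩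
      symm := fun ⟨e⟩ => ⟨e.symm⟩
      trans := fun ⟨e⟩ ⟨f⟩ => ⟨e.trans f⟩ }

/-- `V*(M)`: the isomorphism classes of countably generated modules in `Add(M)`. -/
def VStar : Type (max u (v + 1)) := Quotient (isoSetoid R M)

variable {R M}

theorem IsCountablyGenerated.prod {X Y : Type v} [AddCommGroup X] [Module R X] [AddCommGroup Y]
    [Module R Y] (hX : IsCountablyGenerated R X) (hY : IsCountablyGenerated R Y) :
    IsCountablyGenerated R (X × Y) := by
  obtain ⟨A, hA, hA'⟩ := hX
  obtain ⟨B, hB, hB'⟩ := hY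
  refine ⟨LinearMap.inl R X Y '' A ∪ LinearMap.inr R X Y '' B,
    (hA.image _).union (hB.image _), ?_⟩
  rw [LinearMap.span_inl_union_inr, hA', hB', Submodule.prod_top]

theorem InAdd.prod {X Y : Type v} [AddCommGroup X] [Module R X] [AddCommGroup Y]
    [Module R Y] (hX : InAdd R M X) (hY : InAdd R M Y) : InAdd R M (X × Y) := by
  obtain ⟨I, X', ⟨e⟩⟩ := hX
  obtain ⟨J, Y', ⟨f⟩⟩ := hY
  refine ⟨I ⊕ J, ModuleCat.of R (X' × Y'), ⟨?_⟩⟩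
  exact (LinearEquiv.prodProdProdComm R X Y X' Y').trans
    ((LinearEquiv.prodCongr e f).trans (Finsupp.sumFinsuppLEquivProdFinsupp R).symm)

/-- The direct sum `X ⊕ Y` of countably generated modules in `Add(M)`. -/
def AddCtbl.sum (X Y : AddCtbl R M) : AddCtbl R M :=
  ⟨ModuleCat.of R (X.1 × Y.1), X.2.1.prod Y.2.1, X.2.2.prod Y.2.2⟩

/-- The zero module, as a member of `Add(M)`. -/
def AddCtbl.zero : AddCtbl R M :=
  ⟨ModuleCat.of R PUnit.{v + 1}, ⟨∅, Set.countable_empty, Subsingleton.elim _ _⟩,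
    PEmpty.{v + 1}, ModuleCat.of R PUnit.{v + 1}, ⟨0, 0, fun _ => rfl, fun _ => Subsingleton.elim _ _⟩⟩

/-- The class `[X]` in `V*(M)`. -/
def VStar.mk (X : AddCtbl R M) : VStar R M := Quotient.mk (isoSetoid R M) X

theorem VStar.sound {X Y : AddCtbl R M} (e : X.1 ≃ₗ[R] Y.1) : VStar.mk X = VStar.mk Y :=
  Quotient.sound (s := isoSetoid R M) ⟨e⟩

/-- Addition on `V*(M)`: `[X] + [Y] = [X ⊕ Y]`. -/
instance : Add (VStar R M) where
  add := Quotient.map₂ (sa := isoSetoid R M) (sb := isoSetoid R M) (sc := isoSetoid R M)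
    AddCtbl.sum (fun _ _ ⟨e⟩ _ _ ⟨f⟩ => ⟨LinearEquiv.prodCongr e f⟩)

instance : Zero (VStar R M) where
  zero := VStar.mk AddCtbl.zero

instance : AddCommMonoid (VStar R M) where
  add_assoc := by
    rintro ⟨X⟩ ⟨Y⟩ ⟨Z⟩
    exact VStar.sound (LinearEquiv.prodAssoc R X.1 Y.1 Z.1)
  zero_add := by
    rintro ⟨X⟩
    exact VStar.sound (LinearEquiv.uniqueProd (R := R) (M := X.1) (M₂ := PUnit.{v + 1}))
  add_zero := by
    rintro ⟨X⟩
    exact VStar.sound (LinearEquiv.prodUnique (R := R) (M := X.1) (M₂ := PUnit.{v + 1}))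
  add_comm := by
    rintro ⟨X⟩ ⟨Y⟩
    exact VStar.sound (LinearEquiv.prodComm R X.1 Y.1)
  nsmul := nsmulRec

end VStar

section Dim

variable {T : Type w} [Ring T] {s : ℕ}

/-- `V 1, …, V s` is a complete, irredundant list of the simple `T`-modules up to isomorphism. -/
structure IsSimpleSystem (V : Fin s → ModuleCat.{w} T) : Prop where
  simple : ∀ i, IsSimpleModule T (V i)
  irredundant : ∀ i j, Nonempty (V i ≃ₗ[T] V j) → i = j
  complete : ∀ W : ModuleCat.{w} T, IsSimpleModule T W → ∃ i, Nonempty (W ≃ₗ[T] V i)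

/-- The dimension vector of a `T`-module `P`: its `i`-th entry is the dimension of
`Hom_T(V i, P / J(T) P)` over the division ring `End_T(V i)`, which acts on the right by
composition; all infinite dimensions are identified with `∞`. -/
noncomputable def dimVec (V : Fin s → ModuleCat.{w} T) (P : Type v) [AddCommGroup P]
    [Module T P] : Fin s → ℕ∞ := fun i =>
  Cardinal.toENat (Module.rank (EndOp T (V i))
    (V i →ₗ[T] P ⧸ (Ring.jacobson T • ⊤ : Submodule T P)))

theorem dimVec_congr (V : Fin s → ModuleCat.{w} T) {P Q : Type v} [AddCommGroup P]
    [Module T P] [AddCommGroup Q] [Module T Q] (e : P ≃ₗ[T] Q) : dimVec V P = dimVec V Q := by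
  funext i
  have h : Submodule.map (e : P →ₗ[T] Q) (Ring.jacobson T • ⊤) = Ring.jacobson T • ⊤ := by
    rw [Submodule.map_smul'', Submodule.map_top, LinearEquiv.range]
  exact congrArg Cardinal.toENat
    (homCongr (M := V i) (Submodule.Quotient.equiv _ _ e h)).rank_eq

end Dim

section DMap

variable {R : Type u} [Ring R] {M : Type v} [AddCommGroup M] [Module R M]

/-- The map `D_M : V*(M) → (ℕ ∪ {∞})^s` sending `[X]` to the dimension vector of the right
`S`-module `Hom_R(M, X)`, where `S = End_R(M)`. -/
noncomputable def DMap {s : ℕ} (V : Fin s → ModuleCat.{v} (EndOp R M)) :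
    VStar R M → (Fin s → ℕ∞) :=
  Quotient.lift (s := isoSetoid R M) (fun X => dimVec V (M →ₗ[R] X.1))
    (fun _ _ ⟨e⟩ => dimVec_congr V (homCongr e))

end DMap

/-- A morphism `f` of commutative monoids is a divisor homomorphism if `f a ∣ f b` implies
`a ∣ b`, where (additively) `a ∣ b` means that `b = a + c` for some `c`. -/
def IsDivisorHom {A : Type u} {B : Type v} [AddCommMonoid A] [AddCommMonoid B] (f : A →+ B) :
    Prop :=
  ∀ a b : A, (∃ c : B, f b = f a + c) → ∃ c : A, b = a + c

end DirectSummands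

/-! The functor `Hom_R(M, -)` identifies the countably generated modules in `Add(M)` with the
countably generated projective modules over `T = End_R(M)ᵒᵖ`. By a back-and-forth argument such a
projective module `P` is determined by `P / JP`, where `J = J(T)`, hence by its dimension vector.

If the dimension vector of `P` is bounded by that of `Q`, there are `f : P → Q` and `g : Q → P` with
`g f ≡ 1` modulo `J`. Choose a finite `X ⊆ Q` on which every nonzero map from `Q` to a simple module
`V i` of finite multiplicity is nonzero, and let `I` be the ideal spanned by the values of the maps
`Q → T` vanishing on `X`. Then `I` is idempotent and annihilates the `V i` of finite multiplicity,
and `Q / IQ` is finitely generated, so `g` can be changed to achieve `g f ≡ 1` modulo `I`. The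
idempotent `I` is the trace ideal of a countably generated projective module `L` with `IL = L`, and
`1 - g f` factors through a countable power `L^(C)`, so that `P` is a direct summand of
`Q ⊕ L^(C)`. Only infinite multiplicities of `Q` grow on adding `L^(C)`, so `Q ⊕ L^(C) ≅ Q`. -/

namespace DirectSummands

section Semilocal

theorem isSemisimpleModule_of_isTorsionBySet_jacobson {A N : Type*} [Ring A]
    [IsSemisimpleRing (A ⧸ Ring.jacobson A)] [AddCommGroup N] [Module A N]
    (h : Module.IsTorsionBySet A N (Ring.jacobson A)) : IsSemisimpleModule A N := by
  let _ := h.module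
  exact h.isSemisimpleModule_iff.mp inferInstance

instance isSemisimpleModule_quotient_jacobson_smul (A N : Type*) [Ring A]
    [IsSemisimpleRing (A ⧸ Ring.jacobson A)] [AddCommGroup N] [Module A N] :
    IsSemisimpleModule A (N ⧸ (Ring.jacobson A • ⊤ : Submodule A N)) :=
  isSemisimpleModule_of_isTorsionBySet_jacobson
    (Module.isTorsionBySet_quotient_ideal_smul N (Ring.jacobson A))

instance isSemisimpleModule_quotient_jacobson (A : Type*) [Ring A]
    [IsSemisimpleRing (A ⧸ Ring.jacobson A)] : IsSemisimpleModule A (A ⧸ Ring.jacobson A) :=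
  isSemisimpleModule_of_isTorsionBySet_jacobson
    ((Module.isTorsionBySet_quotient_iff _ _).mpr fun x _ hr => Ideal.mul_mem_right x _ hr)

instance isSemisimpleRing_quotient_jacobson_of_finite_maximalSpectrum (R : Type*) [CommRing R]
    [Finite (MaximalSpectrum R)] : IsSemisimpleRing (R ⧸ Ring.jacobson R) := by
  have (m : MaximalSpectrum R) : IsSemisimpleRing (R ⧸ m.asIdeal) :=
    let _ := Ideal.Quotient.field m.asIdeal; inferInstance
  have hJ : Ring.jacobson R = ⨅ m : MaximalSpectrum R, m.asIdeal := by
    ext r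
    rw [Ring.jacobson_eq_sInf_isMaximal, Submodule.mem_sInf, Submodule.mem_iInf]
    exact ⟨fun h m => h _ m.isMaximal, fun h I hI => h ⟨I, hI⟩⟩
  rw [hJ]
  exact (Ideal.quotientInfRingEquivPiQuotient _ fun m n hmn =>
    Ideal.isCoprime_of_isMaximal (mt MaximalSpectrum.ext hmn)).symm.isSemisimpleRing

variable {R T N : Type*} [CommRing R] [Ring T] [Algebra R T]

/- By Schur's lemma `r` acts on `N` bijectively or as zero, and by Nakayama's lemma not
bijectively. -/
theorem smul_eq_zero_of_mem_jacobson [AddCommGroup N] [Module R N] [Module T N]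
    [IsScalarTower R T N] [IsSimpleModule T N] [Module.Finite R N]
    {r : R} (hr : r ∈ Ring.jacobson R) (x : N) : r • x = 0 := by
  have := IsSimpleModule.nontrivial T N
  rcases LinearMap.bijective_or_eq_zero (algebraMap R (Module.End T N) r) with h | h
  · have hle : (⊤ : Submodule R N) ≤ Ring.jacobson R • ⊤ := fun y _ => by
      obtain ⟨z, rfl⟩ := h.surjective y
      exact Submodule.smul_mem_smul hr trivial
    exact absurd (Submodule.FG.eq_bot_of_le_jacobson_smul Module.Finite.fg_top hle) top_ne_bot
  · exact LinearMap.congr_fun h x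

theorem algebraMap_mem_jacobson [Module.Finite R T] {r : R} (hr : r ∈ Ring.jacobson R) :
    algebraMap R T r ∈ Ring.jacobson T := by
  rw [Ring.jacobson_eq_sInf_isMaximal, Submodule.mem_sInf]
  intro I hI
  have : IsSimpleModule T (T ⧸ I) := isSimpleModule_iff_isCoatom.mpr (Ideal.isMaximal_def.mp hI)
  rw [← Submodule.Quotient.mk_eq_zero, Algebra.algebraMap_eq_smul_one, Submodule.Quotient.mk_smul]
  exact smul_eq_zero_of_mem_jacobson (T := T) hr _

theorem isSemisimpleRing_quotient_jacobson_of_finite (R T : Type*) [CommRing R] [Ring T]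
    [Algebra R T] [Module.Finite R T] [IsSemisimpleRing (R ⧸ Ring.jacobson R)] :
    IsSemisimpleRing (T ⧸ Ring.jacobson T) := by
  have htors : Module.IsTorsionBySet R (T ⧸ Ring.jacobson T) (Ring.jacobson R) := by
    rintro x ⟨r, hr⟩
    obtain ⟨x, rfl⟩ := Submodule.Quotient.mk_surjective _ x
    rw [← Submodule.Quotient.mk_smul, Submodule.Quotient.mk_eq_zero, Algebra.smul_def]
    exact Ideal.mul_mem_right _ _ (algebraMap_mem_jacobson hr)
  have := isSemisimpleModule_of_isTorsionBySet_jacobson htors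
  have : IsArtinianRing (T ⧸ Ring.jacobson T) := isArtinian_of_tower R inferInstance
  exact IsArtinianRing.isSemisimpleRing_iff_jacobson.mpr (Ring.jacobson_quotient_jacobson T)

end Semilocal

section SimpleSystem

theorem exists_submodule_linearEquiv_of_isSimpleModule (T : Type*) [Ring T]
    [IsSemisimpleRing (T ⧸ Ring.jacobson T)] (W : Type*) [AddCommGroup W] [Module T W]
    [IsSimpleModule T W] :
    ∃ K : Submodule T (T ⧸ Ring.jacobson T), Nonempty (K ≃ₗ[T] W) := by
  obtain ⟨m, _, ⟨f⟩⟩ := isSimpleModule_iff_quot_maximal.mp ‹IsSimpleModule T W›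
  let g : (T ⧸ Ring.jacobson T) →ₗ[T] W :=
    f.symm.toLinearMap ∘ₗ Submodule.factor (Ring.jacobson_le_of_isMaximal m)
  have hg : Function.Surjective g := f.symm.surjective.comp (Submodule.factor_surjective _)
  obtain ⟨K, ⟨k⟩⟩ := IsSemisimpleModule.exists_submodule_linearEquiv_quotient (LinearMap.ker g)
  exact ⟨K, ⟨k.trans (g.quotKerEquivOfSurjective hg)⟩⟩

theorem exists_isSimpleSystem (T : Type w) [Ring T] [IsSemisimpleRing (T ⧸ Ring.jacobson T)] :
    ∃ (s : ℕ) (V : Fin s → ModuleCat.{w} T), IsSimpleSystem V := by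
  let N := T ⧸ Ring.jacobson T
  obtain ⟨s, ⟨e⟩⟩ := Finite.exists_equiv_fin (isotypicComponents T N)
  choose S hS hSc using fun c : isotypicComponents T N => c.2
  refine ⟨s, fun i => ModuleCat.of T (S (e.symm i)), fun i => hS _, ?_, ?_⟩
  · rintro i j ⟨f⟩
    have f : S (e.symm i) ≃ₗ[T] S (e.symm j) := f
    exact e.symm.injective (Subtype.ext (by rw [hSc, hSc, f.isotypicComponent_eq]))
  · intro W _
    obtain ⟨K, ⟨k⟩⟩ := exists_submodule_linearEquiv_of_isSimpleModule T W
    have : IsSimpleModule T K := IsSimpleModule.congr k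
    let c : isotypicComponents T N := ⟨isotypicComponent T N K, K, ‹_›, rfl⟩
    have hKc : K ≤ isotypicComponent T N (S c) := (hSc c : isotypicComponent T N K = _) ▸
      K.le_isotypicComponent
    have := hS c
    obtain ⟨q⟩ := isIsotypicOfType_submodule_iff.mp
      (IsIsotypicOfType.isotypicComponent T N (S c)) K hKc
    refine ⟨e c, ?_⟩
    rw [Equiv.symm_apply_apply]
    exact ⟨k.symm.trans q⟩

end SimpleSystem

section CongrMod

variable {T P Q : Type*} [Ring T] [AddCommGroup P] [Module T P] [AddCommGroup Q] [Module T Q]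

theorem map_mem_smul_top (I : Ideal T) (f : P →ₗ[T] Q) {x : P} (hx : x ∈ (I • ⊤ : Submodule T P)) :
    f x ∈ (I • ⊤ : Submodule T Q) :=
  Submodule.smul_top_le_comap_smul_top I f hx

/-- The linear maps `f, g : P → Q` agree modulo `I Q`. -/
def CongrMod (I : Ideal T) (f g : P →ₗ[T] Q) : Prop :=
  ∀ x, f x ≡ g x [SMOD (I • ⊤ : Submodule T Q)]

namespace CongrMod

variable {I : Ideal T}

theorem refl (I : Ideal T) (f : P →ₗ[T] Q) : CongrMod I f f := fun _ => SModEq.rfl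

theorem trans {f g h : P →ₗ[T] Q} (hfg : CongrMod I f g) (hgh : CongrMod I g h) :
    CongrMod I f h := fun x => (hfg x).trans (hgh x)

theorem symm {f g : P →ₗ[T] Q} (h : CongrMod I f g) : CongrMod I g f := fun x => (h x).symm

theorem sub_mem {f g : P →ₗ[T] Q} (h : CongrMod I f g) (x : P) :
    f x - g x ∈ (I • ⊤ : Submodule T Q) := SModEq.sub_mem.mp (h x)

theorem comp {N : Type*} [AddCommGroup N] [Module T N] {f f' : P →ₗ[T] Q} {g g' : Q →ₗ[T] N}
    (hg : CongrMod I g g') (hf : CongrMod I f f') : CongrMod I (g ∘ₗ f) (g' ∘ₗ f') := fun x =>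
  (hg (f x)).trans (SModEq.sub_mem.mpr (map_sub g' _ _ ▸ map_mem_smul_top I g' (hf.sub_mem x)))

theorem comp_left {N : Type*} [AddCommGroup N] [Module T N] {f f' : P →ₗ[T] Q}
    (hf : CongrMod I f f') (g : Q →ₗ[T] N) : CongrMod I (g ∘ₗ f) (g ∘ₗ f') :=
  (refl I g).comp hf

end CongrMod

theorem exists_lift_quotient_smul_top [Module.Projective T P] (I : Ideal T)
    (a : (P ⧸ (I • ⊤ : Submodule T P)) →ₗ[T] (Q ⧸ (I • ⊤ : Submodule T Q))) :
    ∃ f : P →ₗ[T] Q, ∀ x, (Submodule.Quotient.mk (f x) : Q ⧸ (I • ⊤ : Submodule T Q)) =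
      a (Submodule.Quotient.mk x) := by
  obtain ⟨f, hf⟩ := Module.projective_lifting_property (Submodule.mkQ (I • ⊤ : Submodule T Q))
    (a ∘ₗ Submodule.mkQ _) (Submodule.mkQ_surjective _)
  exact ⟨f, LinearMap.congr_fun hf⟩

end CongrMod

section Nakayama

variable {T P Q : Type*} [Ring T] [AddCommGroup P] [Module T P] [AddCommGroup Q] [Module T Q]

theorem surjective_of_congrMod_jacobson_id [Module.Finite T P] {h : P →ₗ[T] P}
    (hh : CongrMod (Ring.jacobson T) h LinearMap.id) : Function.Surjective h := by
  have htop : (⊤ : Submodule T (P ⧸ LinearMap.range h)) ≤ Ring.jacobson T • ⊤ := by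
    rintro y -
    obtain ⟨x, rfl⟩ := Submodule.mkQ_surjective _ y
    have hx : (LinearMap.range h).mkQ (x - h x) = (LinearMap.range h).mkQ x := by
      rw [map_sub, sub_eq_self]
      exact (Submodule.Quotient.mk_eq_zero _).mpr ⟨x, rfl⟩
    exact hx ▸ map_mem_smul_top _ _ (hh.symm.sub_mem x)
  rw [← LinearMap.range_eq_top, ← Submodule.Quotient.subsingleton_iff,
    ← Submodule.subsingleton_iff T, ← subsingleton_iff_bot_eq_top]
  exact (Submodule.FG.eq_bot_of_le_jacobson_smul Module.Finite.fg_top htop).symm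

theorem bijective_of_congrMod_jacobson_id [Module.Finite T P] [Module.Projective T P]
    {h : P →ₗ[T] P} (hh : CongrMod (Ring.jacobson T) h LinearMap.id) : Function.Bijective h := by
  obtain ⟨d, hd⟩ := Module.projective_lifting_property h LinearMap.id
    (surjective_of_congrMod_jacobson_id hh)
  have hd_id : CongrMod (Ring.jacobson T) d LinearMap.id := fun x =>
    (hh (d x)).symm.trans (by rw [← LinearMap.comp_apply, hd])
  have hinv : Function.RightInverse d h := LinearMap.congr_fun hd
  exact ⟨(hinv.leftInverse_of_surjective
    (surjective_of_congrMod_jacobson_id hd_id)).injective, hinv.surjective⟩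

theorem exists_factor_finsupp_on_finset [Module.Projective T P] (X : Finset P) :
    ∃ (S : Finset P) (π : P →ₗ[T] (S →₀ T)) (ι : (S →₀ T) →ₗ[T] P), ∀ x ∈ X, ι (π x) = x := by
  classical
  obtain ⟨s, hs⟩ := Module.projective_def.mp ‹Module.Projective T P›
  refine ⟨X.biUnion fun x => (s x).support, Finsupp.lsubtypeDomain _ ∘ₗ s,
    Finsupp.linearCombination T Subtype.val, fun x hx => ?_⟩
  conv_rhs => rw [← hs x]
  refine Finsupp.sum_subtypeDomain_index (h := fun y t => t • y) fun y hy => ?_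
  exact Finset.mem_biUnion.mpr ⟨x, hx, hy⟩

/- On `X` the map `h` is inverted by an automorphism of a finite free module through which the
identity of `X` factors. -/
theorem exists_leftInverse_on_finset [Module.Projective T P] {h : P →ₗ[T] P}
    (hh : CongrMod (Ring.jacobson T) h LinearMap.id) (X : Finset P) :
    ∃ v : P →ₗ[T] P, CongrMod (Ring.jacobson T) v LinearMap.id ∧ ∀ x ∈ X, v (h x) = x := by
  obtain ⟨S, π, ι, hιπ⟩ := exists_factor_finsupp_on_finset (T := T) X
  let c : (S →₀ T) →ₗ[T] (S →₀ T) := π ∘ₗ h ∘ₗ ι + (LinearMap.id - π ∘ₗ ι)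
  have hc : CongrMod (Ring.jacobson T) c LinearMap.id := fun y => by
    have hcy : c y - y = π (h (ι y) - ι y) := by simp [c]; abel
    exact SModEq.sub_mem.mpr (hcy ▸ map_mem_smul_top _ π (hh.sub_mem (ι y)))
  let e := LinearEquiv.ofBijective c (bijective_of_congrMod_jacobson_id hc)
  refine ⟨LinearMap.id - (h - LinearMap.id) ∘ₗ ι ∘ₗ e.symm ∘ₗ π, fun y => ?_, fun x hx => ?_⟩
  · refine SModEq.sub_mem.mpr ?_
    simpa using hh.symm.sub_mem (ι (e.symm (π y)))
  · have hex : e.symm (π (h x)) = π x := e.symm_apply_eq.mpr (by simp [e, c, hιπ x hx])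
    simp [hex, hιπ x hx]

theorem exists_retraction_on_finset [Module.Projective T P] {f : P →ₗ[T] Q} {g : Q →ₗ[T] P}
    (h : CongrMod (Ring.jacobson T) (g ∘ₗ f) LinearMap.id) (X : Finset P) :
    ∃ g' : Q →ₗ[T] P, CongrMod (Ring.jacobson T) g' g ∧ ∀ x ∈ X, g' (f x) = x := by
  obtain ⟨v, hv, hvX⟩ := exists_leftInverse_on_finset h X
  exact ⟨v ∘ₗ g, hv.comp (CongrMod.refl _ g), hvX⟩

theorem injective_of_congrMod_jacobson_id [Module.Projective T P] {f : P →ₗ[T] Q} {g : Q →ₗ[T] P}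
    (h : CongrMod (Ring.jacobson T) (g ∘ₗ f) LinearMap.id) : Function.Injective f := by
  rw [injective_iff_map_eq_zero]
  intro x hx
  obtain ⟨g', -, hg'⟩ := exists_retraction_on_finset h {x}
  rw [← hg' x (Finset.mem_singleton_self x), hx, map_zero]

end Nakayama

theorem exists_linearMap_eventually_eq {T P Q ι : Type*} [Ring T] [AddCommGroup P] [Module T P]
    [AddCommGroup Q] [Module T Q] {l : Filter ι} [l.NeBot] (f : ι → P →ₗ[T] Q)
    (h : ∀ x, ∃ y, ∀ᶠ n in l, f n x = y) : ∃ F : P →ₗ[T] Q, ∀ x, ∀ᶠ n in l, f n x = F x := by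
  choose F hF using h
  refine ⟨{ toFun := F, map_add' := fun x y => ?_, map_smul' := fun t x => ?_ }, hF⟩
  · obtain ⟨n, ⟨hx, hy⟩, hxy⟩ := (((hF x).and (hF y)).and (hF (x + y))).exists
    rw [← hx, ← hy, ← hxy, map_add]
  · obtain ⟨n, hx, htx⟩ := ((hF x).and (hF (t • x))).exists
    rw [← hx, ← htx, map_smul, RingHom.id_apply]

section BackAndForth

variable {T P Q : Type*} [Ring T] [AddCommGroup P] [Module T P] [AddCommGroup Q] [Module T Q]

/-- The states of the back-and-forth construction of an isomorphism lifting `f` modulo the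
radical: a lift of `f` together with a finite set on which its values are final. -/
structure PartialLift (f : P →ₗ[T] Q) where
  toLinearMap : P →ₗ[T] Q
  congrMod : CongrMod (Ring.jacobson T) toLinearMap f
  dom : Finset P

namespace PartialLift

variable {f : P →ₗ[T] Q}

instance : Preorder (PartialLift f) where
  le k l := k.dom ⊆ l.dom ∧ ∀ x ∈ k.dom, l.toLinearMap x = k.toLinearMap x
  le_refl _ := ⟨Finset.Subset.refl _, fun _ _ => rfl⟩
  le_trans _ _ _ hkl hlm :=
    ⟨hkl.1.trans hlm.1, fun x hx => (hlm.2 x (hkl.1 hx)).trans (hkl.2 x hx)⟩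

theorem eqOn_span {k l : PartialLift f} (h : k ≤ l) :
    Set.EqOn l.toLinearMap k.toLinearMap (Submodule.span T (k.dom : Set P)) :=
  LinearMap.eqOn_span h.2

variable (f) in
/-- The partial lifts whose set of final arguments contains `p`. -/
def cofinalDom (p : P) : Order.Cofinal (PartialLift f) where
  carrier := {k | p ∈ k.dom}
  isCofinal k := by
    classical
    exact ⟨⟨k.toLinearMap, k.congrMod, insert p k.dom⟩, Finset.mem_insert_self p _,
      Finset.subset_insert p _, fun _ _ => rfl⟩

/- The retraction `l` of `k` on `dom` provides the preimage `l q`; a retraction of `l` on the images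
of `dom` and on `q` is then the extension. -/
theorem exists_ge_map_eq [Module.Projective T P] [Module.Projective T Q] {g : Q →ₗ[T] P}
    (hgf : CongrMod (Ring.jacobson T) (g ∘ₗ f) LinearMap.id)
    (hfg : CongrMod (Ring.jacobson T) (f ∘ₗ g) LinearMap.id) (q : Q) (k : PartialLift f) :
    ∃ k' : PartialLift f, (∃ x ∈ k'.dom, k'.toLinearMap x = q) ∧ k ≤ k' := by
  classical
  obtain ⟨l, hl, hlk⟩ := exists_retraction_on_finset ((k.congrMod.comp_left g).trans hgf) k.dom
  obtain ⟨k', hk', hkl⟩ := exists_retraction_on_finset ((k.congrMod.comp hl).trans hfg)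
    (insert q (k.dom.image k.toLinearMap))
  refine ⟨⟨k', hk'.trans k.congrMod, insert (l q) k.dom⟩,
    ⟨l q, Finset.mem_insert_self _ _, hkl q (Finset.mem_insert_self _ _)⟩,
    Finset.subset_insert _ _, fun x hx => ?_⟩
  simpa only [hlk x hx] using
    hkl (k.toLinearMap x) (Finset.mem_insert_of_mem (Finset.mem_image_of_mem _ hx))

/-- The partial lifts that have `q` among their final values. -/
def cofinalRange [Module.Projective T P] [Module.Projective T Q] {g : Q →ₗ[T] P}
    (hgf : CongrMod (Ring.jacobson T) (g ∘ₗ f) LinearMap.id)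
    (hfg : CongrMod (Ring.jacobson T) (f ∘ₗ g) LinearMap.id) (q : Q) :
    Order.Cofinal (PartialLift f) where
  carrier := {k | ∃ x ∈ k.dom, k.toLinearMap x = q}
  isCofinal := exists_ge_map_eq hgf hfg q

theorem exists_limit {a : ℕ → PartialLift f} (ha : Monotone a)
    (hdom : ∀ x, ∃ n, x ∈ Submodule.span T ((a n).dom : Set P)) :
    ∃ F : P →ₗ[T] Q, ∀ n, Set.EqOn F (a n).toLinearMap (Submodule.span T ((a n).dom : Set P)) := by
  obtain ⟨F, hF⟩ := exists_linearMap_eventually_eq (l := Filter.atTop)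
    (fun n => (a n).toLinearMap) fun x => by
      obtain ⟨n, hn⟩ := hdom x
      exact ⟨_, Filter.eventually_atTop.mpr ⟨n, fun m hm => eqOn_span (ha hm) hn⟩⟩
  refine ⟨F, fun n x hx => ?_⟩
  obtain ⟨m, hm, hmn⟩ := ((hF x).and (Filter.eventually_ge_atTop n)).exists
  exact hm.symm.trans (eqOn_span (ha hmn) hx)

end PartialLift

theorem nonempty_linearEquiv_of_congrMod [Module.Projective T P] [Module.Projective T Q]
    (hP : IsCountablyGenerated T P) (hQ : IsCountablyGenerated T Q)
    {f : P →ₗ[T] Q} {g : Q →ₗ[T] P}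
    (hgf : CongrMod (Ring.jacobson T) (g ∘ₗ f) LinearMap.id)
    (hfg : CongrMod (Ring.jacobson T) (f ∘ₗ g) LinearMap.id) : Nonempty (P ≃ₗ[T] Q) := by
  obtain ⟨A, hA, hAP⟩ := hP
  obtain ⟨B, hB, hBQ⟩ := hQ
  have := hA.toEncodable
  have := hB.toEncodable
  let D : A ⊕ B → Order.Cofinal (PartialLift f) :=
    Sum.elim (fun p => PartialLift.cofinalDom f p) fun q => PartialLift.cofinalRange hgf hfg q
  let a : ℕ → PartialLift f := Order.sequenceOfCofinals ⟨f, CongrMod.refl _ f, ∅⟩ D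
  have hmono : Monotone a := Order.sequenceOfCofinals.monotone _ D
  have hmem (i : A ⊕ B) : ∃ n, a n ∈ D i := ⟨_, Order.sequenceOfCofinals.encode_mem _ D i⟩
  have hdom (x : P) : ∃ n, x ∈ Submodule.span T ((a n).dom : Set P) := by
    rw [← Submodule.mem_iSup_of_directed _ (Monotone.directed_le fun _ _ h =>
      Submodule.span_mono (Finset.coe_subset.mpr (hmono h).1))]
    refine (hAP ▸ Submodule.span_le.mpr fun p hp => ?_ : (⊤ : Submodule T P) ≤ _) trivial
    obtain ⟨n, hn⟩ := hmem (.inl ⟨p, hp⟩)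
    exact Submodule.mem_iSup_of_mem n (Submodule.subset_span hn)
  obtain ⟨F, hF⟩ := PartialLift.exists_limit hmono hdom
  refine ⟨LinearEquiv.ofBijective F ⟨(injective_iff_map_eq_zero F).mpr fun x hx => ?_, ?_⟩⟩
  · obtain ⟨n, hn⟩ := hdom x
    have hinj := injective_of_congrMod_jacobson_id (((a n).congrMod.comp_left g).trans hgf)
    exact (map_eq_zero_iff _ hinj).mp (hF n hn ▸ hx)
  · rw [← LinearMap.range_eq_top, eq_top_iff, ← hBQ, Submodule.span_le]
    intro q hq
    obtain ⟨n, x, hx, hxq⟩ := hmem (.inr ⟨q, hq⟩)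
    exact ⟨x, (hF n (Submodule.subset_span hx)).trans hxq⟩

theorem nonempty_linearEquiv_of_quotient_jacobson [Module.Projective T P] [Module.Projective T Q]
    (hP : IsCountablyGenerated T P) (hQ : IsCountablyGenerated T Q)
    (e : (P ⧸ (Ring.jacobson T • ⊤ : Submodule T P)) ≃ₗ[T]
      (Q ⧸ (Ring.jacobson T • ⊤ : Submodule T Q))) : Nonempty (P ≃ₗ[T] Q) := by
  obtain ⟨f, hf⟩ := exists_lift_quotient_smul_top _ e.toLinearMap
  obtain ⟨g, hg⟩ := exists_lift_quotient_smul_top _ e.symm.toLinearMap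
  exact nonempty_linearEquiv_of_congrMod hP hQ (f := f) (g := g)
    (fun x => by simp [SModEq.def, hf, hg]) (fun x => by simp [SModEq.def, hf, hg])

end BackAndForth

section Hom

variable {R M X Y : Type*} [Ring R] [AddCommGroup M] [Module R M] [AddCommGroup X] [Module R X]
  [AddCommGroup Y] [Module R Y]

/-- Composition with `g : X → Y`, as a map `Hom_R(M, X) → Hom_R(M, Y)` of right
`End_R(M)`-modules. -/
def postcomp (g : X →ₗ[R] Y) : (M →ₗ[R] X) →ₗ[EndOp R M] (M →ₗ[R] Y) where
  toFun f := g ∘ₗ f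
  map_add' _ _ := LinearMap.comp_add _ _ _
  map_smul' _ _ := rfl

/-- The isomorphism `Hom_R(M, X ⊕ Y) ≅ Hom_R(M, X) ⊕ Hom_R(M, Y)` of right
`End_R(M)`-modules. -/
def homProdEquiv : (M →ₗ[R] X × Y) ≃ₗ[EndOp R M] (M →ₗ[R] X) × (M →ₗ[R] Y) where
  toFun f := (LinearMap.fst R X Y ∘ₗ f, LinearMap.snd R X Y ∘ₗ f)
  invFun f := f.1.prod f.2
  map_add' _ _ := rfl
  map_smul' _ _ := rfl

/-- For finitely generated `M`, the right `End_R(M)`-module of maps from `M` to a direct sum of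
copies of `M` is free. -/
noncomputable def homFinsuppEquiv [Module.Finite R M] (I : Type*) :
    (I →₀ EndOp R M) ≃ₗ[EndOp R M] (M →ₗ[R] (I →₀ M)) :=
  LinearEquiv.ofBijective
    { toFun := fun c => LinearMap.finsuppLinearMap ℕ
        (Finsupp.mapRange.addEquiv MulOpposite.opAddEquiv.symm c)
      map_add' := fun _ _ => by rw [map_add, map_add]
      map_smul' := fun _ _ => by ext; rfl } <|
    (LinearMap.finsuppLinearMap_bijective_of_moduleFinite R M M I ℕ).comp
      (AddEquiv.bijective _)

end Hom

section CountablyGenerated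

variable {T P Q : Type*} [Ring T] [AddCommGroup P] [Module T P] [AddCommGroup Q] [Module T Q]

namespace IsCountablyGenerated

theorem of_surjective (hP : IsCountablyGenerated T P) (f : P →ₗ[T] Q)
    (hf : Function.Surjective f) : IsCountablyGenerated T Q := by
  obtain ⟨A, hA, hAP⟩ := hP
  exact ⟨f '' A, hA.image f, by
    rw [Submodule.span_image, hAP, Submodule.map_top, LinearMap.range_eq_top.mpr hf]⟩

theorem self (T : Type*) [Ring T] : IsCountablyGenerated T T :=
  ⟨{1}, Set.countable_singleton 1, Ideal.span_singleton_one⟩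

theorem finsupp (hP : IsCountablyGenerated T P) (κ : Type*) [Countable κ] :
    IsCountablyGenerated T (κ →₀ P) := by
  obtain ⟨A, hA, hAP⟩ := hP
  refine ⟨⋃ k, Finsupp.lsingle (R := T) k '' A, Set.countable_iUnion fun k => hA.image _, ?_⟩
  simp_rw [Submodule.span_iUnion, Submodule.span_image, hAP, Submodule.map_top,
    Finsupp.iSup_lsingle_range]

theorem countable_index [Nontrivial P] {κ : Type*} (h : IsCountablyGenerated T (κ →₀ P)) :
    Countable κ := by
  obtain ⟨A, hA, hAP⟩ := h
  rw [← Set.countable_univ_iff]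
  refine (hA.biUnion fun x _ => x.support.countable_toSet).mono fun k _ => ?_
  by_contra hk
  have hzero : (Finsupp.lapply k : (κ →₀ P) →ₗ[T] P) = 0 := LinearMap.ext_on hAP fun x hx =>
    Finsupp.notMem_support_iff.mp fun hkx => hk (Set.mem_biUnion hx hkx)
  obtain ⟨y, hy⟩ := exists_ne (0 : P)
  exact hy (by simpa using LinearMap.congr_fun hzero (Finsupp.single k y))

end IsCountablyGenerated

theorem exists_finset_span_sup_eq_top (N : Submodule T Q) [Module.Finite T (Q ⧸ N)] :
    ∃ Y : Finset Q, Submodule.span T (Y : Set Q) ⊔ N = ⊤ := by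
  classical
  obtain ⟨S, hS⟩ := (Module.Finite.fg_top : (⊤ : Submodule T (Q ⧸ N)).FG)
  refine ⟨S.image (Function.surjInv N.mkQ_surjective), ?_⟩
  rw [sup_comm, ← Submodule.map_mkQ_eq_top, Submodule.map_span, Finset.coe_image, Set.image_image]
  simpa only [Function.surjInv_eq, Set.image_id'] using hS

end CountablyGenerated

section SimpleSystem

variable {T : Type w} [Ring T] {s : ℕ} {V : Fin s → ModuleCat.{w} T}

namespace IsSimpleSystem

theorem nontrivial (hV : IsSimpleSystem V) (i : Fin s) : Nontrivial (V i) :=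
  have := hV.simple i
  IsSimpleModule.nontrivial T (V i)

theorem strongRankCondition (hV : IsSimpleSystem V) (i : Fin s) :
    StrongRankCondition (EndOp T (V i)) := by
  classical
  have := hV.simple i
  let _ : DivisionRing (Module.End T (V i)) := Module.End.instDivisionRing
  infer_instance

theorem free (hV : IsSimpleSystem V) (i : Fin s) (N : Type*) [AddCommGroup N]
    [Module (EndOp T (V i)) N] : Module.Free (EndOp T (V i)) N := by
  classical
  have := hV.simple i
  let _ : DivisionRing (Module.End T (V i)) := Module.End.instDivisionRing
  infer_instance

theorem linearMap_eq_zero (hV : IsSimpleSystem V) {i j : Fin s} (hij : i ≠ j)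
    (f : V i →ₗ[T] V j) : f = 0 := by
  have := hV.simple i
  have := hV.simple j
  exact f.bijective_or_eq_zero.resolve_left fun h =>
    hij (hV.irredundant i j ⟨LinearEquiv.ofBijective f h⟩)

theorem lapply_comp_ne_zero (hV : IsSimpleSystem V) {i : Fin s} {Q : Type*} [AddCommGroup Q]
    [Module T Q] {κ : Type*}
    {p : Q →ₗ[T] (κ →₀ V i)} (hp : Function.Surjective p) (j : κ) :
    Finsupp.lapply j ∘ₗ p ≠ 0 := by
  have := hV.nontrivial i
  obtain ⟨v, hv⟩ := exists_ne (0 : V i)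
  obtain ⟨x, hx⟩ := hp (Finsupp.single j v)
  exact fun hzero => hv (by simpa [hx] using LinearMap.congr_fun hzero x)

theorem exists_linearEquiv_pi_finsupp (hV : IsSimpleSystem V) (A : Type w) [AddCommGroup A]
    [Module T A] [IsSemisimpleModule T A] :
    ∃ κ : Fin s → Type w, Nonempty (A ≃ₗ[T] ∀ i, (κ i →₀ V i)) := by
  classical
  obtain ⟨S, e, -, hS⟩ := IsSemisimpleModule.exists_linearEquiv_dfinsupp T A
  choose t ht using fun m : S => hV.complete (ModuleCat.of T m.1) (hS m)
  let κ (i : Fin s) : Type w := {m : S // t m = i}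
  have f (k : Σ i, κ i) : Nonempty (k.2.1.1 ≃ₗ[T] V k.1) := by
    obtain ⟨_, m, rfl⟩ := k
    exact ht m
  exact ⟨κ, ⟨e ≪≫ₗ DirectSum.lequivCongrLeft T (Equiv.sigmaFiberEquiv t).symm
    ≪≫ₗ DFinsupp.mapRange.linearEquiv (fun k => (f k).some)
    ≪≫ₗ DirectSum.sigmaLcurryEquiv T (δ := fun i (_ : κ i) => V i)
    ≪≫ₗ DFinsupp.mapRange.linearEquiv (fun i => (finsuppLEquivDirectSum T (V i) (κ i)).symm)
    ≪≫ₗ DirectSum.linearEquivFunOnFintype T (Fin s) fun i => κ i →₀ V i⟩⟩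

theorem rank_hom_pi_finsupp (hV : IsSimpleSystem V) (κ : Fin s → Type w) (i : Fin s) :
    Module.rank (EndOp T (V i)) (V i →ₗ[T] ∀ k, (κ k →₀ V k)) = Cardinal.mk (κ i) := by
  have := hV.simple i
  have := hV.strongRankCondition i
  let g : (V i →ₗ[T] ∀ k, (κ k →₀ V k)) →ₗ[EndOp T (V i)] (V i →ₗ[T] (κ i →₀ V i)) :=
    postcomp (LinearMap.proj i)
  have hg : Function.Bijective g := by
    refine ⟨(injective_iff_map_eq_zero g).mpr fun f hf => ?_, fun f => ?_⟩
    · ext v k : 2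
      obtain rfl | hik := eq_or_ne i k
      · exact LinearMap.congr_fun hf v
      · ext j
        exact LinearMap.congr_fun
          (hV.linearMap_eq_zero hik (Finsupp.lapply j ∘ₗ LinearMap.proj k ∘ₗ f)) v
    · exact ⟨LinearMap.single T (fun k => (κ k →₀ V k)) i ∘ₗ f,
        LinearMap.ext fun _ => Pi.single_eq_same _ _⟩
  rw [(LinearEquiv.ofBijective g hg).rank_eq, ← (homFinsuppEquiv (κ i)).rank_eq, rank_finsupp_self,
    Cardinal.lift_id]

theorem dimVec_apply_of_linearEquiv (hV : IsSimpleSystem V) {P : Type w} [AddCommGroup P]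
    [Module T P] {κ : Fin s → Type w}
    (e : (P ⧸ (Ring.jacobson T • ⊤ : Submodule T P)) ≃ₗ[T] ∀ i, (κ i →₀ V i)) (i : Fin s) :
    dimVec V P i = Cardinal.toENat (Cardinal.mk (κ i)) := by
  rw [← hV.rank_hom_pi_finsupp κ i]
  exact congrArg Cardinal.toENat (homCongr (M := V i) e).rank_eq

theorem countable_of_surjective (hV : IsSimpleSystem V) {P : Type w} [AddCommGroup P]
    [Module T P] (hP : IsCountablyGenerated T P) {κ : Fin s → Type w}
    {g : P →ₗ[T] ∀ i, (κ i →₀ V i)} (hg : Function.Surjective g) (i : Fin s) :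
    Countable (κ i) := by
  have := hV.nontrivial i
  exact (hP.of_surjective (LinearMap.proj i ∘ₗ g)
    ((LinearMap.proj_surjective (R := T) i).comp hg)).countable_index

end IsSimpleSystem

theorem mk_le_mk_of_toENat_le {κ κ' : Type w} [Countable κ]
    (h : Cardinal.toENat (Cardinal.mk κ) ≤ Cardinal.toENat (Cardinal.mk κ')) :
    Cardinal.mk κ ≤ Cardinal.mk κ' :=
  (Cardinal.toENat_le_iff_of_le_aleph0 Cardinal.mk_le_aleph0).mp h

end SimpleSystem

section Multiplicity

variable {T : Type w} [Ring T] [IsSemisimpleRing (T ⧸ Ring.jacobson T)] {s : ℕ}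
  {V : Fin s → ModuleCat.{w} T} {P Q : Type w} [AddCommGroup P] [Module T P]
  [AddCommGroup Q] [Module T Q]

namespace IsSimpleSystem

theorem exists_linearEquiv_quotient_jacobson (hV : IsSimpleSystem V)
    (hP : IsCountablyGenerated T P) :
    ∃ κ : Fin s → Type w, (∀ i, Countable (κ i)) ∧
      (∀ i, dimVec V P i = Cardinal.toENat (Cardinal.mk (κ i))) ∧
      Nonempty ((P ⧸ (Ring.jacobson T • ⊤ : Submodule T P)) ≃ₗ[T] ∀ i, (κ i →₀ V i)) := by
  obtain ⟨κ, ⟨e⟩⟩ := hV.exists_linearEquiv_pi_finsupp (P ⧸ (Ring.jacobson T • ⊤ : Submodule T P))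
  exact ⟨κ, hV.countable_of_surjective (g := e.toLinearMap ∘ₗ Submodule.mkQ _) hP
    (e.surjective.comp (Submodule.mkQ_surjective _)), hV.dimVec_apply_of_linearEquiv e, ⟨e⟩⟩

theorem nonempty_linearEquiv_quotient_of_dimVec_eq (hV : IsSimpleSystem V)
    (hP : IsCountablyGenerated T P) (hQ : IsCountablyGenerated T Q)
    (h : dimVec V P = dimVec V Q) :
    Nonempty ((P ⧸ (Ring.jacobson T • ⊤ : Submodule T P)) ≃ₗ[T]
      (Q ⧸ (Ring.jacobson T • ⊤ : Submodule T Q))) := by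
  obtain ⟨κ, hκ, hκP, ⟨e⟩⟩ := hV.exists_linearEquiv_quotient_jacobson hP
  obtain ⟨κ', hκ', hκQ, ⟨e'⟩⟩ := hV.exists_linearEquiv_quotient_jacobson hQ
  have hequiv (i : Fin s) : Nonempty (κ i ≃ κ' i) := by
    have hi := congrFun h i
    rw [hκP, hκQ] at hi
    exact Cardinal.eq.mp ((mk_le_mk_of_toENat_le hi.le).antisymm (mk_le_mk_of_toENat_le hi.ge))
  exact ⟨e ≪≫ₗ LinearEquiv.piCongrRight (fun i => Finsupp.domLCongr (hequiv i).some) ≪≫ₗ e'.symm⟩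

theorem exists_leftInverse_quotient_of_dimVec_le (hV : IsSimpleSystem V)
    (hP : IsCountablyGenerated T P) (h : dimVec V P ≤ dimVec V Q) :
    ∃ (a : (P ⧸ (Ring.jacobson T • ⊤ : Submodule T P)) →ₗ[T]
        (Q ⧸ (Ring.jacobson T • ⊤ : Submodule T Q)))
      (b : (Q ⧸ (Ring.jacobson T • ⊤ : Submodule T Q)) →ₗ[T]
        (P ⧸ (Ring.jacobson T • ⊤ : Submodule T P))), Function.LeftInverse b a := by
  obtain ⟨κ, hκ, hκP, ⟨e⟩⟩ := hV.exists_linearEquiv_quotient_jacobson hP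
  obtain ⟨κ', ⟨e'⟩⟩ :=
    hV.exists_linearEquiv_pi_finsupp (Q ⧸ (Ring.jacobson T • ⊤ : Submodule T Q))
  have hemb (i : Fin s) : Nonempty (κ i ↪ κ' i) := by
    have hi := h i
    rw [hκP, hV.dimVec_apply_of_linearEquiv e'] at hi
    exact mk_le_mk_of_toENat_le hi
  let j := fun i => (hemb i).some
  let a : (∀ i, (κ i →₀ V i)) →ₗ[T] ∀ i, (κ' i →₀ V i) :=
    LinearMap.piMap fun i => Finsupp.lmapDomain (V i) T (j i)
  let b : (∀ i, (κ' i →₀ V i)) →ₗ[T] ∀ i, (κ i →₀ V i) :=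
    LinearMap.piMap fun i => Finsupp.lcomapDomain (j i) (j i).injective
  have hba : Function.LeftInverse b a := fun x =>
    funext fun i => Finsupp.comapDomain_mapDomain _ (j i).injective _
  exact ⟨e'.symm ∘ₗ a ∘ₗ e, e.symm ∘ₗ b ∘ₗ e', fun x => by simp [hba _]⟩

end IsSimpleSystem
end Multiplicity

section Detection

variable {T : Type w} [Ring T] [IsSemisimpleRing (T ⧸ Ring.jacobson T)] {s : ℕ}
  {V : Fin s → ModuleCat.{w} T} {Q : Type w} [AddCommGroup Q] [Module T Q]

namespace IsSimpleSystem

theorem exists_isotypic_quotient (hV : IsSimpleSystem V) (Q : Type w) [AddCommGroup Q]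
    [Module T Q] (i : Fin s) :
    ∃ (κ : Type w) (p : Q →ₗ[T] (κ →₀ V i)), Function.Surjective p ∧
      (∀ f : Q →ₗ[T] V i, LinearMap.ker p ≤ LinearMap.ker f) ∧
      dimVec V Q i = Cardinal.toENat (Cardinal.mk κ) := by
  have := hV.simple i
  obtain ⟨κ, ⟨e⟩⟩ := hV.exists_linearEquiv_pi_finsupp (Q ⧸ (Ring.jacobson T • ⊤ : Submodule T Q))
  refine ⟨κ i, LinearMap.proj i ∘ₗ e.toLinearMap ∘ₗ Submodule.mkQ _,
    (LinearMap.proj_surjective (R := T) i).comp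
      (e.surjective.comp (Submodule.mkQ_surjective _)),
    fun f x hx => ?_, hV.dimVec_apply_of_linearEquiv e i⟩
  have hJ : (Ring.jacobson T • ⊤ : Submodule T Q) ≤ LinearMap.ker f :=
    Submodule.smul_le.mpr fun r hr y _ => by
      rw [LinearMap.mem_ker, map_smul]
      exact Module.mem_annihilator.mp (IsSemisimpleModule.jacobson_le_annihilator T (V i) hr) _
  let f' : (∀ k, (κ k →₀ V k)) →ₗ[T] V i := Submodule.liftQ _ f hJ ∘ₗ e.symm
  have hf' (y : ∀ k, (κ k →₀ V k)) (hy : y i = 0) : f' y = 0 := by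
    rw [← Finset.univ_sum_single y, map_sum]
    refine Finset.sum_eq_zero fun k _ => ?_
    obtain rfl | hki := eq_or_ne k i
    · rw [hy, Pi.single_zero, map_zero]
    · have hzero : f' ∘ₗ LinearMap.single T _ k = 0 := Finsupp.lhom_ext' fun j =>
        hV.linearMap_eq_zero hki _
      exact LinearMap.congr_fun hzero (y k)
  simpa [f'] using hf' (e (Submodule.mkQ _ x)) hx

theorem exists_finset_detecting_of_dimVec_ne_top (hV : IsSimpleSystem V) {i : Fin s}
    (hi : dimVec V Q i ≠ ⊤) :
    ∃ Y : Finset Q, ∀ f : Q →ₗ[T] V i, (∀ y ∈ Y, f y = 0) → f = 0 := by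
  have := hV.simple i
  obtain ⟨κ, p, hp, hker, hdim⟩ := hV.exists_isotypic_quotient Q i
  have : Finite κ := by
    rwa [hdim, Ne, Cardinal.toENat_eq_top, not_le, Cardinal.lt_aleph0_iff_finite] at hi
  have := Module.Finite.equiv (p.quotKerEquivOfSurjective hp).symm
  obtain ⟨Y, hY⟩ := exists_finset_span_sup_eq_top (LinearMap.ker p)
  refine ⟨Y, fun f hf => LinearMap.ker_eq_top.mp (top_le_iff.mp ?_)⟩
  rw [← hY]
  exact sup_le (Submodule.span_le.mpr hf) (hker f)

theorem exists_finset_detecting (hV : IsSimpleSystem V) (Q : Type w) [AddCommGroup Q]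
    [Module T Q] :
    ∃ X : Finset Q, ∀ i, dimVec V Q i ≠ ⊤ → ∀ f : Q →ₗ[T] V i, (∀ x ∈ X, f x = 0) → f = 0 := by
  classical
  choose Y hY using fun i : {i // dimVec V Q i ≠ ⊤} =>
    hV.exists_finset_detecting_of_dimVec_ne_top i.2
  exact ⟨Finset.univ.biUnion Y, fun i hi f hf => hY ⟨i, hi⟩ f fun y hy =>
    hf y (Finset.mem_biUnion.mpr ⟨_, Finset.mem_univ _, hy⟩)⟩

theorem exists_ne_zero_of_dimVec_eq_top (hV : IsSimpleSystem V) {i : Fin s}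
    (hi : dimVec V Q i = ⊤) (X : Finset Q) :
    ∃ f : Q →ₗ[T] V i, (∀ x ∈ X, f x = 0) ∧ f ≠ 0 := by
  classical
  obtain ⟨κ, p, hp, -, hdim⟩ := hV.exists_isotypic_quotient Q i
  rw [hdim, Cardinal.toENat_eq_top, ← Cardinal.infinite_iff] at hi
  obtain ⟨j, hj⟩ := Infinite.exists_notMem_finset (X.biUnion fun x => (p x).support)
  exact ⟨Finsupp.lapply j ∘ₗ p, fun x hx => Finsupp.notMem_support_iff.mp fun hjx =>
    hj (Finset.mem_biUnion.mpr ⟨x, hx, hjx⟩), hV.lapply_comp_ne_zero hp j⟩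

theorem dimVec_eq_zero (hV : IsSimpleSystem V) {i : Fin s} (h : ∀ f : Q →ₗ[T] V i, f = 0) :
    dimVec V Q i = 0 := by
  obtain ⟨κ, p, hp, -, hdim⟩ := hV.exists_isotypic_quotient Q i
  have : IsEmpty κ := ⟨fun j => hV.lapply_comp_ne_zero hp j (h _)⟩
  rw [hdim, Cardinal.mk_eq_zero, map_zero]

end IsSimpleSystem

end Detection

section DimVec

variable {T : Type w} [Ring T] {s : ℕ} {V : Fin s → ModuleCat.{w} T}
  {P Q : Type w} [AddCommGroup P] [Module T P] [AddCommGroup Q] [Module T Q]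

/-- The isomorphism `(P ⊕ Q) / I(P ⊕ Q) ≅ P / IP ⊕ Q / IQ`. -/
def quotientProdEquiv (I : Ideal T) : ((P × Q) ⧸ (I • ⊤ : Submodule T (P × Q))) ≃ₗ[T]
    (P ⧸ (I • ⊤ : Submodule T P)) × (Q ⧸ (I • ⊤ : Submodule T Q)) :=
  LinearEquiv.ofLinearMap
    (LinearMap.prod
      (Submodule.mapQ _ _ (LinearMap.fst T P Q) fun _ hx => map_mem_smul_top I _ hx)
      (Submodule.mapQ _ _ (LinearMap.snd T P Q) fun _ hx => map_mem_smul_top I _ hx))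
    (LinearMap.coprod
      (Submodule.mapQ _ _ (LinearMap.inl T P Q) fun _ hx => map_mem_smul_top I _ hx)
      (Submodule.mapQ _ _ (LinearMap.inr T P Q) fun _ hx => map_mem_smul_top I _ hx))
    (by
      refine LinearMap.prod_ext (Submodule.linearMap_qext _ ?_) (Submodule.linearMap_qext _ ?_) <;>
      ext <;> simp)
    (by
      refine Submodule.linearMap_qext _ (LinearMap.ext fun ⟨x, y⟩ => ?_)
      simp [← Submodule.Quotient.mk_add])

theorem IsSimpleSystem.dimVec_prod (hV : IsSimpleSystem V) :
    dimVec V (P × Q) = dimVec V P + dimVec V Q := by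
  funext i
  have := hV.strongRankCondition i
  have := hV.free i
  simp only [dimVec, Pi.add_apply]
  rw [(homCongr (M := V i) (quotientProdEquiv (P := P) (Q := Q) (Ring.jacobson T)) ≪≫ₗ
    homProdEquiv).rank_eq, rank_prod', map_add]

theorem IsSimpleSystem.dimVec_of_subsingleton (hV : IsSimpleSystem V) [Subsingleton P] :
    dimVec V P = 0 := by
  funext i
  have := hV.strongRankCondition i
  have := hV.nontrivial i
  have : Subsingleton (V i →ₗ[T] P ⧸ (Ring.jacobson T • ⊤ : Submodule T P)) :=
    ⟨fun f g => LinearMap.ext fun x => Subsingleton.elim _ _⟩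
  rw [Pi.zero_apply, dimVec, rank_subsingleton', map_zero]

end DimVec

section Telescope

variable {T F : Type*} [Ring T] [AddCommGroup F] [Module T F]

/-- The endomorphism of `F^(ℕ)` sending `x` in degree `n` to `x` in degree `n` minus `φ x` in
degree `n + 1`; its cokernel is the telescope of `φ`. -/
noncomputable def telescopeMap (φ : F →ₗ[T] F) : (ℕ →₀ F) →ₗ[T] (ℕ →₀ F) :=
  Finsupp.lsum ℕ fun n => Finsupp.lsingle n - Finsupp.lsingle (n + 1) ∘ₗ φ

theorem telescopeMap_single (φ : F →ₗ[T] F) (n : ℕ) (x : F) :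
    telescopeMap φ (Finsupp.single n x) = Finsupp.single n x - Finsupp.single (n + 1) (φ x) :=
  Finsupp.lsum_single _ _ _ _

/-- The telescope of an endomorphism `φ` of `F`: the colimit of `F → F → F → ⋯` with all maps
equal to `φ`. -/
abbrev Telescope (φ : F →ₗ[T] F) : Type _ := (ℕ →₀ F) ⧸ LinearMap.range (telescopeMap φ)

namespace Telescope

/-- The structure map of the telescope on the `n`-th term of `F → F → F → ⋯`. -/
noncomputable def of (φ : F →ₗ[T] F) (n : ℕ) : F →ₗ[T] Telescope φ :=
  Submodule.mkQ _ ∘ₗ Finsupp.lsingle n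

theorem of_succ_comp (φ : F →ₗ[T] F) (n : ℕ) : of φ (n + 1) ∘ₗ φ = of φ n :=
  LinearMap.ext fun x => .symm <| (Submodule.Quotient.eq _).mpr
    ⟨Finsupp.single n x, telescopeMap_single φ n x⟩

theorem iSup_range_of (φ : F →ₗ[T] F) : ⨆ n, LinearMap.range (of φ n) = ⊤ := by
  simp_rw [of, LinearMap.range_comp, ← Submodule.map_iSup, Finsupp.iSup_lsingle_range,
    Submodule.map_top, Submodule.range_mkQ]

/-- The maps `B n` for which `x ↦ single n x + B n (φ x)` is a left inverse of `telescopeMap φ`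
whenever `θ φ φ = φ`; they solve the recursion `B (n + 1) φ φ = B n φ - single (n + 1) φ`. -/
noncomputable def correction (θ : F →ₗ[T] F) : ℕ → F →ₗ[T] (ℕ →₀ F)
  | 0 => 0
  | n + 1 => (correction θ n - Finsupp.lsingle (n + 1)) ∘ₗ θ

variable {φ θ : F →ₗ[T] F}

theorem exists_leftInverse_telescopeMap (h : θ ∘ₗ φ ∘ₗ φ = φ) :
    ∃ ρ : (ℕ →₀ F) →ₗ[T] (ℕ →₀ F), ρ ∘ₗ telescopeMap φ = LinearMap.id := by
  refine ⟨Finsupp.lsum ℕ fun n => Finsupp.lsingle n + correction θ n ∘ₗ φ,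
    Finsupp.lhom_ext fun n x => ?_⟩
  have hx : θ (φ (φ x)) = φ x := LinearMap.congr_fun h x
  simp only [LinearMap.comp_apply, telescopeMap_single, map_sub, Finsupp.lsum_single,
    LinearMap.add_apply, LinearMap.sub_apply, correction, Finsupp.lsingle_apply, hx,
    LinearMap.id_apply]
  abel

theorem projective [Module.Projective T F] (h : θ ∘ₗ φ ∘ₗ φ = φ) :
    Module.Projective T (Telescope φ) := by
  classical
  have : Module.Projective T (ℕ →₀ F) := .of_equiv (finsuppLequivDFinsupp T).symm
  obtain ⟨ρ, hρ⟩ := exists_leftInverse_telescopeMap h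
  have hle : LinearMap.range (telescopeMap φ) ≤
      LinearMap.ker (LinearMap.id - telescopeMap φ ∘ₗ ρ) := by
    rw [LinearMap.range_le_ker_iff, LinearMap.sub_comp, LinearMap.comp_assoc, hρ,
      LinearMap.id_comp, LinearMap.comp_id, sub_self]
  refine .of_split (Submodule.liftQ _ _ hle) (Submodule.mkQ _)
    (Submodule.linearMap_qext _ (LinearMap.ext fun x => ?_))
  refine (Submodule.Quotient.eq _).mpr ⟨-ρ x, ?_⟩
  simp

theorem exists_comp_of_zero (h : θ ∘ₗ φ ∘ₗ φ = φ) :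
    ∃ r : Telescope φ →ₗ[T] F, r ∘ₗ of φ 0 = φ := by
  refine ⟨Submodule.liftQ _ (Finsupp.lsum ℕ fun n => (θ ^ n) ∘ₗ φ) ?_, ?_⟩
  · refine LinearMap.range_le_ker_iff.mpr (Finsupp.lhom_ext fun n x => ?_)
    have hx : θ (φ (φ x)) = φ x := LinearMap.congr_fun h x
    rw [LinearMap.comp_apply, telescopeMap_single, map_sub, Finsupp.lsum_single,
      Finsupp.lsum_single, LinearMap.comp_apply, LinearMap.comp_apply, pow_succ,
      Module.End.mul_apply, hx, sub_self, LinearMap.zero_apply]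
  · ext x
    simp [of]

theorem smul_top_eq_top {I : Ideal T} (h : ∀ x, φ x ∈ (I • ⊤ : Submodule T F)) :
    (I • ⊤ : Submodule T (Telescope φ)) = ⊤ := by
  refine top_le_iff.mp ((iSup_range_of φ).ge.trans (iSup_le fun n => ?_))
  rintro _ ⟨x, rfl⟩
  rw [← of_succ_comp]
  exact map_mem_smul_top I (of φ (n + 1)) (h x)

end Telescope

end Telescope

section IdempotentIdeal

variable {T : Type w} [Ring T]

theorem exists_right_generators [IsNoetherianRing Tᵐᵒᵖ] (I : Ideal T) [I.IsTwoSided] :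
    ∃ (m : ℕ) (x : Fin m → T), (∀ j, x j ∈ I) ∧
      ∀ y ∈ I, ∃ t : Fin m → T, y = ∑ j, x j * t j := by
  let N : Submodule Tᵐᵒᵖ T :=
    { I.toAddSubmonoid with smul_mem' := fun t _ hy => I.mul_mem_right t.unop hy }
  have : IsNoetherian Tᵐᵒᵖ T := isNoetherian_of_linearEquiv (MulOpposite.opLinearEquiv Tᵐᵒᵖ).symm
  obtain ⟨m, x, hx⟩ := Submodule.fg_iff_exists_fin_generating_family.mp (IsNoetherian.noetherian N)
  refine ⟨m, x, fun j => hx.le (Submodule.subset_span ⟨j, rfl⟩), fun y hy => ?_⟩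
  obtain ⟨t, ht⟩ := (Submodule.mem_span_range_iff_exists_fun _).mp (hx.ge hy)
  exact ⟨fun j => (t j).unop, ht.symm⟩

variable {I : Ideal T} {ι : Type*} [Fintype ι] {x : ι → T}

theorem exists_eq_sum_mul_mul (hI : IsIdempotentElem I)
    (hxI : ∀ y ∈ I, ∃ t : ι → T, y = ∑ j, x j * t j) {y : T} (hy : y ∈ I) :
    ∃ c : ι → ι → T, y = ∑ j, ∑ k, x j * x k * c j k := by
  rw [← hI.eq] at hy
  refine Submodule.mul_induction_on hy (fun a ha b hb => ?_) ?_
  · obtain ⟨t, rfl⟩ := hxI a ha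
    choose c hc using fun j => hxI (t j * b) (I.mul_mem_left _ hb)
    refine ⟨c, ?_⟩
    simp only [Finset.sum_mul, mul_assoc, hc, Finset.mul_sum]
  · rintro _ _ ⟨c, rfl⟩ ⟨d, rfl⟩
    exact ⟨c + d, by simp only [Pi.add_apply, mul_add, Finset.sum_add_distrib]⟩

/-- The endomorphism of the free module on words in `ι` sending a word `v` to
`∑ j, x j • (j :: v)`. If the `x j` generate an idempotent ideal `I` as a right ideal, its
telescope is a projective module with trace ideal `I`. -/
noncomputable def wordExtend (x : ι → T) : (List ι →₀ T) →ₗ[T] (List ι →₀ T) :=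
  Finsupp.linearCombination T fun v => ∑ j, x j • Finsupp.single (j :: v) (1 : T)

/-- The endomorphism of the free module on words in `ι` sending a word `k :: j :: v` to
`∑ i, c i j k • (i :: v)`, and words of length at most one to `0`.
For suitable coefficients it undoes the second of two applications of `wordExtend`. -/
noncomputable def wordContract (c : ι → ι → ι → T) : (List ι →₀ T) →ₗ[T] (List ι →₀ T) :=
  Finsupp.linearCombination T fun
    | k :: j :: v => ∑ i, c i j k • Finsupp.single (i :: v) (1 : T)
    | _ => 0

theorem wordExtend_single (x : ι → T) (v : List ι) :
    wordExtend x (Finsupp.single v 1) = ∑ j, x j • Finsupp.single (j :: v) (1 : T) :=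
  (Finsupp.linearCombination_single _ _ _).trans (one_smul _ _)

theorem wordContract_single_cons_cons (c : ι → ι → ι → T) (k j : ι) (v : List ι) :
    wordContract c (Finsupp.single (k :: j :: v) 1) =
      ∑ i, c i j k • Finsupp.single (i :: v) (1 : T) :=
  (Finsupp.linearCombination_single _ _ _).trans (one_smul _ _)

theorem wordContract_comp_wordExtend_comp_wordExtend {c : ι → ι → ι → T}
    (hc : ∀ i, x i = ∑ j, ∑ k, x j * x k * c i j k) :
    wordContract c ∘ₗ wordExtend x ∘ₗ wordExtend x = wordExtend x := by
  refine Finsupp.lhom_ext' fun v => LinearMap.ext_ring ?_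
  simp only [LinearMap.comp_apply, Finsupp.lsingle_apply, wordExtend_single, map_sum, map_smul,
    wordContract_single_cons_cons]
  calc ∑ j, x j • ∑ k, x k • ∑ i, c i j k • Finsupp.single (i :: v) (1 : T)
      = ∑ j, ∑ k, ∑ i, (x j * x k * c i j k) • Finsupp.single (i :: v) (1 : T) := by
        simp only [Finset.smul_sum, smul_smul, mul_assoc]
    _ = ∑ i, ∑ j, ∑ k, (x j * x k * c i j k) • Finsupp.single (i :: v) (1 : T) := by
        rw [Finset.sum_comm_cycle]
    _ = ∑ i, x i • Finsupp.single (i :: v) (1 : T) := by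
        simp only [← Finset.sum_smul, ← hc]

theorem wordExtend_mem_smul_top (hx : ∀ j, x j ∈ I) (y : List ι →₀ T) :
    wordExtend x y ∈ (I • ⊤ : Submodule T (List ι →₀ T)) := by
  have hle : LinearMap.range (wordExtend x) ≤ (I • ⊤ : Submodule T (List ι →₀ T)) := by
    rw [wordExtend, Finsupp.range_linearCombination, Submodule.span_le]
    rintro _ ⟨v, rfl⟩
    exact sum_mem fun j _ => Submodule.smul_mem_smul (hx j) Submodule.mem_top
  exact hle ⟨y, rfl⟩

theorem exists_projective_smul_top_eq_top [IsNoetherianRing Tᵐᵒᵖ] [I.IsTwoSided]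
    (hI : IsIdempotentElem I) :
    ∃ (L : ModuleCat.{w} T), Module.Projective T L ∧ IsCountablyGenerated T L ∧
      (I • ⊤ : Submodule T L) = ⊤ ∧ ∃ l : L, ∀ y ∈ I, ∃ f : L →ₗ[T] T, f l = y := by
  obtain ⟨m, x, hx, hxI⟩ := exists_right_generators I
  choose c hc using fun i => exists_eq_sum_mul_mul hI hxI (hx i)
  have hθφ := wordContract_comp_wordExtend_comp_wordExtend hc
  obtain ⟨r, hr⟩ := Telescope.exists_comp_of_zero hθφ
  refine ⟨ModuleCat.of T (Telescope (wordExtend x)), Telescope.projective hθφ,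
    (((IsCountablyGenerated.self T).finsupp _).finsupp ℕ).of_surjective (Submodule.mkQ _)
      (Submodule.mkQ_surjective _),
    Telescope.smul_top_eq_top (wordExtend_mem_smul_top hx),
    Telescope.of _ 0 (Finsupp.single [] 1), fun y hy => ?_⟩
  obtain ⟨t, rfl⟩ := hxI y hy
  refine ⟨Finsupp.linearCombination T (fun v : List (Fin m) => v.head?.elim 0 t) ∘ₗ r, ?_⟩
  rw [LinearMap.comp_apply, ← LinearMap.comp_apply r, hr, wordExtend_single]
  simp

end IdempotentIdeal

section RelativeTrace

variable {T : Type*} [Ring T] {Q : Type*} [AddCommGroup Q] [Module T Q]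

/-- The trace ideal of `Q` relative to `X`: the ideal of `T` spanned by the values of the maps
`Q → T` that vanish on `X`. -/
def relTrace (T : Type*) [Ring T] {Q : Type*} [AddCommGroup Q] [Module T Q] (X : Set Q) :
    Ideal T :=
  Submodule.span T {y | ∃ h : Q →ₗ[T] T, (∀ x ∈ X, h x = 0) ∧ ∃ q, h q = y}

theorem apply_mem_relTrace {X : Set Q} {h : Q →ₗ[T] T} (hX : ∀ x ∈ X, h x = 0) (q : Q) :
    h q ∈ relTrace T X :=
  Submodule.subset_span ⟨h, hX, q, rfl⟩

theorem relTrace_le_iff {X : Set Q} {J : Ideal T} :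
    relTrace T X ≤ J ↔ ∀ h : Q →ₗ[T] T, (∀ x ∈ X, h x = 0) → ∀ q, h q ∈ J :=
  Submodule.span_le.trans
    ⟨fun H h hX q => H ⟨h, hX, q, rfl⟩, fun H _ ⟨h, hX, q, hq⟩ => hq ▸ H h hX q⟩

instance relTrace_isTwoSided (X : Set Q) : (relTrace T X).IsTwoSided where
  mul_mem_of_left b ha :=
    have hle : relTrace T X ≤ Submodule.comap (LinearMap.toSpanSingleton T T b) (relTrace T X) :=
      relTrace_le_iff.mpr fun h hX q =>
        apply_mem_relTrace (h := LinearMap.toSpanSingleton T T b ∘ₗ h)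
          (fun x hx => by rw [LinearMap.comp_apply, hX x hx, map_zero]) q
    hle ha

theorem smul_eq_zero_of_mem_relTrace {X : Set Q} {N : Type*} [AddCommGroup N] [Module T N]
    (hX : ∀ f : Q →ₗ[T] N, (∀ x ∈ X, f x = 0) → f = 0) {y : T} (hy : y ∈ relTrace T X) (v : N) :
    y • v = 0 :=
  have hle : relTrace T X ≤ LinearMap.ker (LinearMap.toSpanSingleton T N v) :=
    relTrace_le_iff.mpr fun h hh q => LinearMap.congr_fun
      (hX (LinearMap.toSpanSingleton T N v ∘ₗ h) fun x hx => by
        rw [LinearMap.comp_apply, hh x hx, map_zero]) q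
  hle hy

/- Only finitely many of the coordinates of a splitting `Q → T^(Q)` are nonzero on `X`. -/
theorem finite_quotient_relTrace [Module.Projective T Q] {X : Set Q} (hX : X.Finite) :
    Module.Finite T (Q ⧸ (relTrace T X • ⊤ : Submodule T Q)) := by
  obtain ⟨σ, hσ⟩ := (Module.projective_def' (R := T) (P := Q)).mp inferInstance
  let Y : Set Q := ⋃ x ∈ X, (σ x).support
  have hY (a : Q) (ha : a ∉ Y) (q : Q) : σ q a ∈ relTrace T X :=
    apply_mem_relTrace (h := Finsupp.lapply a ∘ₗ σ) (fun x hx => Finsupp.notMem_support_iff.mp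
      fun hax => ha (Set.mem_biUnion hx hax)) q
  have hYfin : Y.Finite := hX.biUnion fun x _ => (σ x).support.finite_toSet
  refine ⟨Submodule.fg_def.mpr ⟨_, hYfin.image (Submodule.mkQ _), ?_⟩⟩
  rw [← Submodule.map_span, Submodule.map_mkQ_eq_top, eq_top_iff]
  intro q _
  rw [← LinearMap.id_apply (R := T) q, ← hσ, LinearMap.comp_apply, Finsupp.linearCombination_apply]
  refine sum_mem fun a _ => ?_
  by_cases ha : a ∈ Y
  · exact Submodule.mem_sup_right (Submodule.smul_mem _ _ (Submodule.subset_span ha))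
  · exact Submodule.mem_sup_left (Submodule.smul_mem_smul (hY a ha q) Submodule.mem_top)

end RelativeTrace

section Idempotence

variable {T : Type w} [Ring T] [IsSemisimpleRing (T ⧸ Ring.jacobson T)] {s : ℕ}
  {V : Fin s → ModuleCat.{w} T} {Q : Type w} [AddCommGroup Q] [Module T Q]
  [Module.Projective T Q] {X : Finset Q}

namespace IsSimpleSystem

theorem exists_mem_relTrace_smul_ne_zero (hV : IsSimpleSystem V) (X : Finset Q) {i : Fin s}
    (hi : dimVec V Q i = ⊤) : ∃ y ∈ relTrace T (X : Set Q), ∃ v : V i, y • v ≠ 0 := by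
  have := finite_quotient_relTrace (T := T) X.finite_toSet
  obtain ⟨Y, hY⟩ := exists_finset_span_sup_eq_top (relTrace T (X : Set Q) • ⊤ : Submodule T Q)
  obtain ⟨f, hfY, hf⟩ := hV.exists_ne_zero_of_dimVec_eq_top hi Y
  by_contra! hI
  refine hf (LinearMap.ker_eq_top.mp (top_le_iff.mp (hY.ge.trans
    (sup_le (Submodule.span_le.mpr hfY) (Submodule.smul_le.mpr fun r hr q _ => ?_)))))
  rw [LinearMap.mem_ker, map_smul, hI r hr]

/- A simple quotient of `I / I²` is a `V i` annihilated by `I = relTrace T X`, so `i` has finite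
multiplicity in `Q`; but then any `I → V i` kills the values of the maps `Q → I` vanishing
on `X`. -/
theorem isIdempotentElem_relTrace [IsNoetherianRing T] (hV : IsSimpleSystem V)
    (hX : ∀ i, dimVec V Q i ≠ ⊤ → ∀ f : Q →ₗ[T] V i, (∀ x ∈ X, f x = 0) → f = 0) :
    IsIdempotentElem (relTrace T (X : Set Q)) := by
  set I := relTrace T (X : Set Q)
  by_contra hne
  have htop : Submodule.comap I.subtype (I * I) ≠ ⊤ := fun h =>
    hne (Ideal.mul_le_left.antisymm (Submodule.comap_subtype_eq_top.mp h))
  obtain ⟨m, hm, hIm⟩ := (eq_top_or_exists_le_coatom _).resolve_left htop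
  have hm' : IsSimpleModule T (I ⧸ m) := isSimpleModule_iff_isCoatom.mpr hm
  obtain ⟨i, ⟨e⟩⟩ := hV.complete (ModuleCat.of T (I ⧸ m)) hm'
  let f : I →ₗ[T] V i := e.toLinearMap ∘ₗ m.mkQ
  have hf : Function.Surjective f := e.surjective.comp m.mkQ_surjective
  by_cases hi : dimVec V Q i = ⊤
  · obtain ⟨y, hy, v, hyv⟩ := hV.exists_mem_relTrace_smul_ne_zero X hi
    obtain ⟨z, rfl⟩ := hf v
    have hyz : y • z ∈ m := hIm (Ideal.mul_mem_mul hy z.2)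
    exact hyv (by rw [← map_smul, LinearMap.comp_apply, Submodule.mkQ_apply,
      (Submodule.Quotient.mk_eq_zero m).mpr hyz, map_zero])
  · have hle : I ≤ (LinearMap.ker f).map I.subtype := relTrace_le_iff.mpr fun h hh q =>
      let h' : Q →ₗ[T] I := h.codRestrict I (apply_mem_relTrace hh)
      ⟨h' q, LinearMap.congr_fun (hX i hi (f ∘ₗ h') fun x hx =>
        (congrArg f (Subtype.ext (hh x hx))).trans (map_zero f)) q, rfl⟩
    have hzero : f = 0 := LinearMap.ext fun z => by
      obtain ⟨z', hz', hzz'⟩ := hle z.2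
      exact Subtype.ext hzz' ▸ hz'
    have := hV.nontrivial i
    obtain ⟨v, hv⟩ := exists_ne (0 : V i)
    obtain ⟨z, rfl⟩ := hf v
    exact hv (LinearMap.congr_fun hzero z)

end IsSimpleSystem

end Idempotence

section Lifting

variable {T : Type*} [Ring T] {P Q L N : Type*} [AddCommGroup P] [Module T P]
  [AddCommGroup Q] [Module T Q] [AddCommGroup L] [Module T L] [AddCommGroup N] [Module T N]

theorem injective_mapQ_of_congrMod_jacobson_id [Module.Projective T P] (I : Ideal T)
    {f : P →ₗ[T] Q} {g : Q →ₗ[T] P} (h : CongrMod (Ring.jacobson T) (g ∘ₗ f) LinearMap.id) :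
    Function.Injective
      (Submodule.mapQ (I • ⊤) (I • ⊤) f (Submodule.smul_top_le_comap_smul_top I f)) := by
  rw [injective_iff_map_eq_zero]
  rintro ⟨x⟩ hx
  have hfx : f x ∈ (I • ⊤ : Submodule T Q) := (Submodule.Quotient.mk_eq_zero _).mp hx
  obtain ⟨g', -, hg'⟩ := exists_retraction_on_finset h {x}
  refine (Submodule.Quotient.mk_eq_zero _).mpr ?_
  rw [← hg' x (Finset.mem_singleton_self x)]
  exact map_mem_smul_top I g' hfx

theorem exists_congrMod_id_of_finite_quotient [IsNoetherianRing T] [Module.Projective T P]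
    (I : Ideal T) [Module.Finite T (Q ⧸ (I • ⊤ : Submodule T Q))] {f : P →ₗ[T] Q} {g : Q →ₗ[T] P}
    (h : CongrMod (Ring.jacobson T) (g ∘ₗ f) LinearMap.id) :
    ∃ g' : Q →ₗ[T] P, CongrMod I (g' ∘ₗ f) LinearMap.id := by
  have : IsNoetherian T (P ⧸ (I • ⊤ : Submodule T P)) :=
    isNoetherian_of_injective _ (injective_mapQ_of_congrMod_jacobson_id I h)
  let k : Module.End T (P ⧸ (I • ⊤ : Submodule T P)) :=
    Submodule.mapQ _ _ (g ∘ₗ f) (Submodule.smul_top_le_comap_smul_top I _)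
  have hk : CongrMod (Ring.jacobson T) k LinearMap.id := by
    rintro ⟨x⟩
    exact SModEq.sub_mem.mpr (map_mem_smul_top _ (Submodule.mkQ _) (h.sub_mem x))
  let e := LinearEquiv.ofBijective k (IsNoetherian.bijective_of_surjective_endomorphism k
    (surjective_of_congrMod_jacobson_id hk))
  obtain ⟨u, hu⟩ := exists_lift_quotient_smul_top I e.symm.toLinearMap
  exact ⟨u ∘ₗ g, fun x => (hu (g (f x))).trans (e.symm_apply_apply (Submodule.Quotient.mk x))⟩

theorem smul_top_le_iSup_range {I : Ideal T} {l : L} (hl : ∀ y ∈ I, ∃ f : L →ₗ[T] T, f l = y)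
    (N : Type*) [AddCommGroup N] [Module T N] :
    (I • ⊤ : Submodule T N) ≤ ⨆ f : L →ₗ[T] N, LinearMap.range f :=
  Submodule.smul_le.mpr fun y hy x _ => by
    obtain ⟨f, rfl⟩ := hl y hy
    exact Submodule.mem_iSup_of_mem (LinearMap.toSpanSingleton T N x ∘ₗ f) ⟨l, rfl⟩

theorem exists_countable_factor_finsupp [Module.Projective T P] (hP : IsCountablyGenerated T P)
    {d : P →ₗ[T] N} (hd : LinearMap.range d ≤ ⨆ f : L →ₗ[T] N, LinearMap.range f) :
    ∃ (C : Set (L →ₗ[T] N)) (a : P →ₗ[T] (C →₀ L)) (b : (C →₀ L) →ₗ[T] N),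
      C.Countable ∧ b ∘ₗ a = d := by
  obtain ⟨A, hA, hAP⟩ := hP
  choose s hs using fun x => Submodule.mem_iSup_iff_exists_finset.mp (hd ⟨x, rfl⟩)
  let C : Set (L →ₗ[T] N) := ⋃ x ∈ A, (s x : Set (L →ₗ[T] N))
  let b : (C →₀ L) →ₗ[T] N := Finsupp.lsum ℕ fun f : C => f.1
  have hb : LinearMap.range d ≤ LinearMap.range b := by
    rw [LinearMap.range_eq_map, ← hAP, Submodule.map_span_le]
    refine fun x hx => (iSup₂_le fun f hf => ?_ : _ ≤ LinearMap.range b) (hs x)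
    rintro _ ⟨z, rfl⟩
    exact ⟨Finsupp.single ⟨f, Set.mem_biUnion hx hf⟩ z, by simp [b]⟩
  obtain ⟨a, ha⟩ := Module.projective_lifting_property b.rangeRestrict
    (d.codRestrict (LinearMap.range b) fun x => hb ⟨x, rfl⟩) b.surjective_rangeRestrict
  exact ⟨C, a, b, hA.biUnion fun x _ => (s x).countable_toSet,
    LinearMap.ext fun x => congrArg Subtype.val (LinearMap.congr_fun ha x)⟩

theorem linearMap_eq_zero_of_smul_top_eq_top {I : Ideal T} (hL : (I • ⊤ : Submodule T L) = ⊤)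
    (hN : ∀ y ∈ I, ∀ v : N, y • v = 0) (f : L →ₗ[T] N) : f = 0 := by
  rw [← LinearMap.ker_eq_top, eq_top_iff, ← hL, Submodule.smul_le]
  intro y hy z _
  rw [LinearMap.mem_ker, map_smul, hN y hy]

end Lifting

section Splitting

variable {T : Type w} [Ring T] [IsSemisimpleRing (T ⧸ Ring.jacobson T)] {s : ℕ}
  {V : Fin s → ModuleCat.{w} T} {P Q L : Type w} [AddCommGroup P] [Module T P]
  [AddCommGroup Q] [Module T Q] [AddCommGroup L] [Module T L]

namespace IsSimpleSystem

theorem dimVec_prod_eq_left (hV : IsSimpleSystem V)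
    (h : ∀ i, dimVec V Q i ≠ ⊤ → ∀ f : L →ₗ[T] V i, f = 0) :
    dimVec V (Q × L) = dimVec V Q := by
  rw [hV.dimVec_prod]
  funext i
  by_cases hi : dimVec V Q i = ⊤
  · rw [Pi.add_apply, hi, top_add]
  · rw [Pi.add_apply, hV.dimVec_eq_zero (h i hi), add_zero]

theorem nonempty_linearEquiv_of_dimVec_eq (hV : IsSimpleSystem V) [Module.Projective T P]
    [Module.Projective T Q] (hP : IsCountablyGenerated T P) (hQ : IsCountablyGenerated T Q)
    (h : dimVec V P = dimVec V Q) : Nonempty (P ≃ₗ[T] Q) :=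
  let ⟨e⟩ := hV.nonempty_linearEquiv_quotient_of_dimVec_eq hP hQ h
  nonempty_linearEquiv_of_quotient_jacobson hP hQ e

theorem nonempty_prod_finsupp_linearEquiv (hV : IsSimpleSystem V) [Module.Projective T Q]
    [Module.Projective T L] (hQ : IsCountablyGenerated T Q) (hL : IsCountablyGenerated T L)
    (h : ∀ i, dimVec V Q i ≠ ⊤ → ∀ f : L →ₗ[T] V i, f = 0) (C : Type w) [Countable C] :
    Nonempty ((Q × (C →₀ L)) ≃ₗ[T] Q) := by
  classical
  have : Module.Projective T (C →₀ L) := .of_equiv (finsuppLequivDFinsupp T).symm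
  refine hV.nonempty_linearEquiv_of_dimVec_eq (hQ.prod (hL.finsupp C)) hQ
    (hV.dimVec_prod_eq_left fun i hi f => ?_)
  exact Finsupp.lhom_ext' fun c => h i hi _

theorem exists_leftInverse_of_dimVec_le [IsNoetherianRing T] [IsNoetherianRing Tᵐᵒᵖ]
    (hV : IsSimpleSystem V) [Module.Projective T P] [Module.Projective T Q]
    (hP : IsCountablyGenerated T P) (hQ : IsCountablyGenerated T Q)
    (h : dimVec V P ≤ dimVec V Q) :
    ∃ (f : P →ₗ[T] Q) (g : Q →ₗ[T] P), g ∘ₗ f = LinearMap.id := by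
  obtain ⟨a, b, hba⟩ := hV.exists_leftInverse_quotient_of_dimVec_le hP h
  obtain ⟨f, hf⟩ := exists_lift_quotient_smul_top _ a
  obtain ⟨g, hg⟩ := exists_lift_quotient_smul_top _ b
  have hgf : CongrMod (Ring.jacobson T) (g ∘ₗ f) LinearMap.id :=
    fun x => by simp [SModEq.def, hf, hg, hba _]
  obtain ⟨X, hX⟩ := hV.exists_finset_detecting Q
  have := finite_quotient_relTrace (T := T) X.finite_toSet
  obtain ⟨g', hg'⟩ := exists_congrMod_id_of_finite_quotient (relTrace T (X : Set Q)) hgf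
  obtain ⟨L, hL, hLc, hLI, l, hl⟩ :=
    exists_projective_smul_top_eq_top (hV.isIdempotentElem_relTrace hX)
  obtain ⟨C, u, v, hC, huv⟩ := exists_countable_factor_finsupp hP
    (d := LinearMap.id - g' ∘ₗ f) <| by
      rintro _ ⟨x, rfl⟩
      exact smul_top_le_iSup_range hl P (hg'.symm.sub_mem x)
  have := hC.to_subtype
  obtain ⟨ε⟩ := hV.nonempty_prod_finsupp_linearEquiv hQ hLc (fun i hi =>
    linearMap_eq_zero_of_smul_top_eq_top hLI fun _ hy =>
      smul_eq_zero_of_mem_relTrace (hX i hi) hy) C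
  refine ⟨ε ∘ₗ f.prod u, g'.coprod v ∘ₗ ε.symm, LinearMap.ext fun x => ?_⟩
  have hvu : v (u x) = x - g' (f x) := LinearMap.congr_fun huv x
  simp [hvu]

end IsSimpleSystem

end Splitting

section Transfer

variable {R : Type u} [Ring R] {M : Type v} [AddCommGroup M] [Module R M]
  {X Y : Type v} [AddCommGroup X] [Module R X] [AddCommGroup Y] [Module R Y]

theorem postcomp_comp {Z : Type*} [AddCommGroup Z] [Module R Z] (b : Y →ₗ[R] Z) (a : X →ₗ[R] Y) :
    (postcomp (b ∘ₗ a) : (M →ₗ[R] X) →ₗ[EndOp R M] (M →ₗ[R] Z)) = postcomp b ∘ₗ postcomp a :=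
  rfl

theorem postcomp_id : (postcomp LinearMap.id : (M →ₗ[R] X) →ₗ[EndOp R M] (M →ₗ[R] X)) =
    LinearMap.id :=
  rfl

theorem homFinsuppEquiv_single_one [Module.Finite R M] {I : Type*} (j : I) :
    homFinsuppEquiv (R := R) (M := M) I (Finsupp.single j 1) = Finsupp.lsingle j := by
  ext m k
  obtain rfl | hjk := eq_or_ne j k
  · simp [homFinsuppEquiv]
  · simp [homFinsuppEquiv, hjk]

namespace InAdd

theorem exists_leftInverse (hX : InAdd R M X) :
    ∃ (I : Type v) (i : X →ₗ[R] (I →₀ M)) (p : (I →₀ M) →ₗ[R] X), p ∘ₗ i = LinearMap.id := by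
  obtain ⟨I, Z, ⟨e⟩⟩ := hX
  exact ⟨I, e ∘ₗ LinearMap.inl R X Z, LinearMap.fst R X Z ∘ₗ e.symm, by ext; simp⟩

theorem exists_countable_leftInverse (hX : InAdd R M X) (hc : IsCountablyGenerated R X) :
    ∃ (C : Type v) (_ : Countable C) (i : X →ₗ[R] (C →₀ M)) (p : (C →₀ M) →ₗ[R] X),
      p ∘ₗ i = LinearMap.id := by
  classical
  obtain ⟨I, i, p, hpi⟩ := hX.exists_leftInverse
  obtain ⟨A, hA, hAX⟩ := hc
  let C : Set I := ⋃ a ∈ A, ((i a).support : Set I)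
  refine ⟨C, (hA.biUnion fun a _ => (i a).support.countable_toSet).to_subtype,
    Finsupp.lsubtypeDomain C ∘ₗ i, Finsupp.lsum ℕ fun j : C => p ∘ₗ Finsupp.lsingle j.1,
    LinearMap.ext_on hAX fun a ha => ?_⟩
  have hsum : (Finsupp.subtypeDomain (· ∈ C) (i a)).sum (fun j m => p (Finsupp.single j.1 m)) =
      (i a).sum fun j m => p (Finsupp.single j m) :=
    Finsupp.sum_subtypeDomain_index (h := fun j m => p (Finsupp.single j m))
      fun j hj => Set.mem_biUnion ha hj
  refine hsum.trans ?_
  rw [← map_finsuppSum, Finsupp.sum_single]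
  exact LinearMap.congr_fun hpi a

theorem postcomp_injective (hX : InAdd R M X) : Function.Injective
    (postcomp : (X →ₗ[R] Y) → (M →ₗ[R] X) →ₗ[EndOp R M] (M →ₗ[R] Y)) := by
  obtain ⟨I, i, p, hpi⟩ := hX.exists_leftInverse
  intro a b hab
  have hp : a ∘ₗ p = b ∘ₗ p :=
    Finsupp.lhom_ext' fun j => LinearMap.congr_fun hab (p ∘ₗ Finsupp.lsingle j)
  rw [← a.comp_id, ← b.comp_id, ← hpi, ← LinearMap.comp_assoc, hp, LinearMap.comp_assoc]

theorem postcomp_surjective [Module.Finite R M] (hX : InAdd R M X) : Function.Surjective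
    (postcomp : (X →ₗ[R] Y) → (M →ₗ[R] X) →ₗ[EndOp R M] (M →ₗ[R] Y)) := by
  obtain ⟨I, i, p, hpi⟩ := hX.exists_leftInverse
  intro φ
  let k : (I →₀ M) →ₗ[R] Y := Finsupp.lsum ℕ fun j => φ (p ∘ₗ Finsupp.lsingle j)
  have hk : postcomp k = φ ∘ₗ postcomp p := by
    rw [← LinearMap.cancel_right (homFinsuppEquiv (R := R) (M := M) I).surjective]
    refine Finsupp.lhom_ext' fun j => LinearMap.ext_ring (LinearMap.ext fun m => ?_)
    simp [homFinsuppEquiv_single_one, postcomp, k]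
  exact ⟨k ∘ₗ i, by
    rw [postcomp_comp, hk, LinearMap.comp_assoc, ← postcomp_comp, hpi, postcomp_id,
      LinearMap.comp_id]⟩

theorem projective_hom [Module.Finite R M] (hX : InAdd R M X) :
    Module.Projective (EndOp R M) (M →ₗ[R] X) := by
  obtain ⟨I, i, p, hpi⟩ := hX.exists_leftInverse
  have : Module.Projective (EndOp R M) (M →ₗ[R] (I →₀ M)) := .of_equiv (homFinsuppEquiv I)
  exact .of_split (postcomp i) (postcomp p) (by rw [← postcomp_comp, hpi, postcomp_id])

theorem isCountablyGenerated_hom [Module.Finite R M] (hX : InAdd R M X)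
    (hc : IsCountablyGenerated R X) : IsCountablyGenerated (EndOp R M) (M →ₗ[R] X) := by
  obtain ⟨C, hC, i, p, hpi⟩ := hX.exists_countable_leftInverse hc
  refine ((IsCountablyGenerated.self (EndOp R M)).finsupp C).of_surjective
    (postcomp p ∘ₗ (homFinsuppEquiv C).toLinearMap) ?_
  refine Function.Surjective.comp (g := postcomp p) (fun f => ⟨i ∘ₗ f, ?_⟩)
    (homFinsuppEquiv C).surjective
  exact congrArg (· ∘ₗ f) hpi

theorem nonempty_linearEquiv_of_hom [Module.Finite R M] (hX : InAdd R M X) (hY : InAdd R M Y)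
    (e : (M →ₗ[R] X) ≃ₗ[EndOp R M] (M →ₗ[R] Y)) : Nonempty (X ≃ₗ[R] Y) := by
  obtain ⟨a, ha⟩ := hX.postcomp_surjective e.toLinearMap
  obtain ⟨b, hb⟩ := hY.postcomp_surjective e.symm.toLinearMap
  refine ⟨LinearEquiv.ofLinearMap a b (hY.postcomp_injective (M := M) ?_)
    (hX.postcomp_injective (M := M) ?_)⟩
  · rw [postcomp_comp, ha, hb, e.comp_symm, postcomp_id]
  · rw [postcomp_comp, ha, hb, e.symm_comp, postcomp_id]

theorem exists_leftInverse_of_hom [Module.Finite R M] (hX : InAdd R M X) (hY : InAdd R M Y)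
    {f : (M →ₗ[R] X) →ₗ[EndOp R M] (M →ₗ[R] Y)} {g : (M →ₗ[R] Y) →ₗ[EndOp R M] (M →ₗ[R] X)}
    (hgf : g ∘ₗ f = LinearMap.id) :
    ∃ (a : X →ₗ[R] Y) (b : Y →ₗ[R] X), b ∘ₗ a = LinearMap.id := by
  obtain ⟨a, rfl⟩ := hX.postcomp_surjective f
  obtain ⟨b, rfl⟩ := hY.postcomp_surjective g
  exact ⟨a, b, hX.postcomp_injective (M := M) hgf⟩

end InAdd

theorem AddCtbl.exists_complement (X Y : AddCtbl R M) {a : X.1 →ₗ[R] Y.1} {b : Y.1 →ₗ[R] X.1}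
    (h : b ∘ₗ a = LinearMap.id) : ∃ Z : AddCtbl R M, Nonempty (Y.1 ≃ₗ[R] X.1 × Z.1) := by
  obtain ⟨e, -⟩ := (LinearMap.exact_subtype_ker_map b).splitSurjectiveEquiv
    (LinearMap.ker b).subtype_injective ⟨a, h⟩
  obtain ⟨I, W, ⟨k⟩⟩ := Y.2.2
  refine ⟨⟨ModuleCat.of R (LinearMap.ker b), ?_, I, ModuleCat.of R (X.1 × W), ⟨?_⟩⟩,
    ⟨e ≪≫ₗ LinearEquiv.prodComm R _ X.1⟩⟩
  · exact Y.2.1.of_surjective (LinearMap.fst R (LinearMap.ker b) X.1 ∘ₗ e.toLinearMap)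
      (Prod.fst_surjective.comp e.surjective)
  · exact (LinearEquiv.prodAssoc R _ X.1 W).symm ≪≫ₗ e.symm.prodCongr (.refl R W) ≪≫ₗ k

end Transfer

section DimensionMap

variable {R : Type u} [Ring R] {M : Type v} [AddCommGroup M] [Module R M] {s : ℕ}
  {V : Fin s → ModuleCat.{v} (EndOp R M)}

namespace IsSimpleSystem

/-- The map `D_M` as a morphism of monoids. -/
noncomputable def dimHom (hV : IsSimpleSystem V) : VStar R M →+ (Fin s → ℕ∞) where
  toFun := DMap V
  map_zero' :=
    have : Subsingleton (M →ₗ[R] PUnit.{v + 1}) := ⟨fun _ _ => LinearMap.ext fun _ => rfl⟩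
    hV.dimVec_of_subsingleton (P := M →ₗ[R] PUnit.{v + 1})
  map_add' := by
    rintro ⟨X⟩ ⟨Y⟩
    exact (dimVec_congr V (homProdEquiv (M := M) (X := X.1) (Y := Y.1))).trans hV.dimVec_prod

variable [Module.Finite R M] [IsSemisimpleRing (EndOp R M ⧸ Ring.jacobson (EndOp R M))]

theorem injective_dimHom (hV : IsSimpleSystem V) : Function.Injective hV.dimHom := by
  rintro ⟨⟨X, hXc, hX⟩⟩ ⟨⟨Y, hYc, hY⟩⟩ (h : dimVec V (M →ₗ[R] X) = dimVec V (M →ₗ[R] Y))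
  have := hX.projective_hom
  have := hY.projective_hom
  obtain ⟨e⟩ := hV.nonempty_linearEquiv_of_dimVec_eq
    (hX.isCountablyGenerated_hom hXc) (hY.isCountablyGenerated_hom hYc) h
  obtain ⟨k⟩ := hX.nonempty_linearEquiv_of_hom hY e
  exact VStar.sound k

theorem isDivisorHom_dimHom [IsNoetherianRing (EndOp R M)] [IsNoetherianRing (EndOp R M)ᵐᵒᵖ]
    (hV : IsSimpleSystem V) : IsDivisorHom hV.dimHom := by
  rintro ⟨X⟩ ⟨Y⟩ ⟨c, h : dimVec V (M →ₗ[R] Y.1) = dimVec V (M →ₗ[R] X.1) + c⟩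
  have := X.2.2.projective_hom
  have := Y.2.2.projective_hom
  obtain ⟨f, g, hgf⟩ := hV.exists_leftInverse_of_dimVec_le
    (X.2.2.isCountablyGenerated_hom X.2.1) (Y.2.2.isCountablyGenerated_hom Y.2.1)
    (h ▸ le_self_add)
  obtain ⟨a, b, hba⟩ := X.2.2.exists_leftInverse_of_hom Y.2.2 hgf
  obtain ⟨Z, ⟨e⟩⟩ := X.exists_complement Y hba
  exact ⟨VStar.mk Z, VStar.sound (Y := X.sum Z) e⟩

end IsSimpleSystem

end DimensionMap

end DirectSummands

open DirectSummands in
theorem mainTheorem11_general (R : Type u) [Ring R] (M : Type v) [AddCommGroup M] [Module R M]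
    [Module.Finite R M] [IsSemisimpleRing (EndOp R M ⧸ Ring.jacobson (EndOp R M))]
    [IsNoetherianRing (Module.End R M)] [IsNoetherianRing (EndOp R M)] :
    (∃ (s : ℕ) (V : Fin s → ModuleCat.{v} (EndOp R M)), IsSimpleSystem V) ∧
    ∀ (s : ℕ) (V : Fin s → ModuleCat.{v} (EndOp R M)), IsSimpleSystem V →
      ∃ D : VStar R M →+ (Fin s → ℕ∞), (D : VStar R M → (Fin s → ℕ∞)) = DMap V ∧
        Function.Injective D ∧ IsDivisorHom D :=
  have : IsNoetherianRing (EndOp R M)ᵐᵒᵖ :=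
    isNoetherianRing_of_ringEquiv _ (RingEquiv.opOp (Module.End R M))
  ⟨exists_isSimpleSystem _, fun _ _ hV =>
    ⟨hV.dimHom, rfl, hV.injective_dimHom, hV.isDivisorHom_dimHom⟩⟩

theorem mainTheorem11 (R : Type u) [CommRing R] [IsNoetherianRing R] [Finite (MaximalSpectrum R)]
    (M : Type v) [AddCommGroup M] [Module R M] [Module.Finite R M] [Nontrivial M] :
    (∃ (s : ℕ) (V : Fin s → ModuleCat.{v} (DirectSummands.EndOp R M)),
      DirectSummands.IsSimpleSystem V) ∧
    ∀ (s : ℕ) (V : Fin s → ModuleCat.{v} (DirectSummands.EndOp R M)), DirectSummands.IsSimpleSystem V →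
      ∃ D : DirectSummands.VStar R M →+ (Fin s → ℕ∞),
        (D : DirectSummands.VStar R M → (Fin s → ℕ∞)) = DirectSummands.DMap V ∧
        Function.Injective D ∧ DirectSummands.IsDivisorHom D :=
  have : Module.Finite R (DirectSummands.EndOp R M) := .equiv (MulOpposite.opLinearEquiv R)
  have : IsNoetherianRing (Module.End R M) := isNoetherian_of_tower R inferInstance
  have : IsNoetherianRing (DirectSummands.EndOp R M) := isNoetherian_of_tower R inferInstance
  have := DirectSummands.isSemisimpleRing_quotient_jacobson_of_finite R (DirectSummands.EndOp R M)
  mainTheorem11_general R M
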